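/- Let $d\ge 2$, let $T$ be the $d$-regular rooted tree, with vertex set the set of finite words over $\{1,\dots,d\}$ (level $n$ consists of the words of length $n$), and let $G\le\operatorname{Aut}(T)$. For a vertex $v$ and $g\in\operatorname{Aut}(T)$ let $\varphi_v(g)\in\operatorname{Aut}(T)$ be the section, defined by $g(vw)=g(v)\,\varphi_v(g)(w)$ for all words $w$. For $K\le\operatorname{Aut}(T)$ let $\operatorname{Stab}_K(v)$ be the stabilizer of $v$ in $K$, $\operatorname{Stab}_K(\mathcal L_n)$ the pointwise stabilizer of level $n$, $\operatorname{Rist}_K(v)$ the subgroup of elements of $K$ fixing every vertex that does not have $v$ as a prefix, and $\operatorname{Rist}_K(\mathcal L_n)$ the subgroup generated by the $\operatorname{Rist}_K(v)$ with $v$ of level $n$. Then: - $G$ is *branch* if it acts transitively on every level, every $\operatorname{Rist}_G(v)$ is infinite, and every $\operatorname{Rist}_G(\mathcal L_n)$ has finite index in $G$. - $G$ is *self-similar* if $\varphi_v(\operatorname{Stab}_G(v))\le G$ for all vertices $v$; *self-replicating* if $\varphi_v(\operatorname{Stab}_G(v))=G$ for all $v$; *strongly self-replicating* if it is self-similar and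 $\varphi_v(\operatorname{Stab}_G(\mathcal L_n))=G$ for all $n$ and all $v$ of level $n$. - $G$ has the *congruence subgroup property* if every finite index subgroup of $G$ contains $\operatorname{Stab}_G(\mathcal L_n)$ for some $n$. - A self-similar $G$ has the *subgroup induction property* if every inductive class of subgroups of $G$ contains all finitely generated subgroups of $G$. Here a class $\mathcal X$ of subgroups of $G$ is inductive if (A) $\{1\},G\in\mathcal X$; (B) whenever $H\le L\le G$ with $[L:H]<\infty$, one has $L\in\mathcal X$ if and only if $H\in\mathcal X$; (C) every finitely generated $H\le\operatorname{Stab}_G(\mathcal L_1)$ such that $\varphi_v(H)\in\mathcal X$ for all $v$ of level $1$ belongs to $\mathcal X$. - $\Phi_F(G)$ is the intersection of all maximal subgroups of $G$ that have finite index in $G$. - Two groups are *commensurable* if they have isomorphic subgroups of finite index. **Theorem.** Let $G\le\operatorname{Aut}(T)$ be a self-replicating branch group such that $\operatorname{Stab}_G(v)=\operatorname{Stab}_G(\mathcal L_1)$ for every vertex $v$ of level $1$. Suppose that $G$ has the subgroup induction property, and let $H$ be an infinite finitely generated subgroup of $G$. Then $H$ is commensurable with one of the direct powers $G, G^2,\dots,G^{d-1}$.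 If moreover $G$ is strongly self-replicating, has the congruence subgroup property and $\Phi_F(G)\neq 1$, then every maximal subgroup of $H$ has finite index in $H$. -/

import Mathlib

namespace RootedTree

/-- The group of automorphisms of the `d`-regular rooted tree. Its vertices are the words over the
alphabet `Fin d`, the root is the empty word, and `v ≤ w` in the tree order means that `v` is a
prefix of `w`. The automorphisms of the rooted tree are those of this order, with composition as
multiplication and the evaluation action `g • v = g v` on vertices. -/
abbrev TreeAut (d : ℕ) : Type :=
  (fun v w : List (Fin d) => v <+: w) ≃r (fun v w : List (Fin d) => v <+: w)

/-- The `n`-th level of the tree. -/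
def level (d n : ℕ) : Set (List (Fin d)) := {v | v.length = n}

section Sections

theorem TreeAut.prefix_iff {d : ℕ} (g : TreeAut d) (v w : List (Fin d)) :
    g v <+: g w ↔ v <+: w := g.map_rel_iff

theorem TreeAut.length_le {d : ℕ} (g : TreeAut d) (v : List (Fin d)) :
    v.length ≤ (g v).length := by
  induction v using List.reverseRecOn with
  | nil => simp
  | append_singleton v a ih =>
    have h1 : g v <+: g (v ++ [a]) := (g.prefix_iff _ _).2 (List.prefix_append _ _)
    by_contra hlt
    have h2 : (g (v ++ [a])).length ≤ (g v).length := by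
      simp only [List.length_append, List.length_singleton] at hlt
      omega
    have h3 := g.injective (h1.eq_of_length_le h2)
    simp at h3

/-- Automorphisms of the rooted tree preserve the levels. -/
theorem TreeAut.length_eq {d : ℕ} (g : TreeAut d) (v : List (Fin d)) :
    (g v).length = v.length := by
  refine le_antisymm ?_ (g.length_le v)
  have h := TreeAut.length_le g.symm (g v)
  rwa [RelIso.symm_apply_apply] at h

/-- The map underlying the section of `g` at `v`: delete the prefix `g v` of `g (v ++ w)`. -/
def TreeAut.sectionFun {d : ℕ} (g : TreeAut d) (v w : List (Fin d)) : List (Fin d) :=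
  (g (v ++ w)).drop v.length

theorem TreeAut.append_sectionFun {d : ℕ} (g : TreeAut d) (v w : List (Fin d)) :
    g v ++ g.sectionFun v w = g (v ++ w) := by
  have h : g v <+: g (v ++ w) := (g.prefix_iff _ _).2 (List.prefix_append _ _)
  have h2 := List.prefix_iff_eq_append.1 h
  rwa [g.length_eq] at h2

/-- The section `φ_v(g) = g|_{T_v}` of the automorphism `g` at the vertex `v`. -/
def TreeAut.sectionAt {d : ℕ} (g : TreeAut d) (v : List (Fin d)) : TreeAut d where
  toFun w := g.sectionFun v w
  invFun w := TreeAut.sectionFun g.symm (g v) w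
  left_inv w := by
    have h := TreeAut.append_sectionFun g.symm (g v) (g.sectionFun v w)
    rw [g.append_sectionFun, RelIso.symm_apply_apply, RelIso.symm_apply_apply] at h
    exact List.append_cancel_left h
  right_inv w := by
    have h := g.append_sectionFun v (TreeAut.sectionFun g.symm (g v) w)
    have h2 := TreeAut.append_sectionFun g.symm (g v) w
    rw [RelIso.symm_apply_apply] at h2
    rw [h2, RelIso.apply_symm_apply] at h
    exact List.append_cancel_left h
  map_rel_iff' {w w'} := by
    change g.sectionFun v w <+: g.sectionFun v w' ↔ w <+: w'
    rw [← List.prefix_append_right_inj (g v), g.append_sectionFun, g.append_sectionFun,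
      g.prefix_iff, List.prefix_append_right_inj]

/-- The defining property `g · (vw) = (g · v)(φ_v(g) · w)` of the section. -/
theorem TreeAut.apply_append {d : ℕ} (g : TreeAut d) (v w : List (Fin d)) :
    g (v ++ w) = g v ++ g.sectionAt v w := (g.append_sectionFun v w).symm

end Sections

section Subgroups

/-- `Stab_G(v)`, the stabilizer of a vertex. -/
def stab {d : ℕ} (G : Subgroup (TreeAut d)) (v : List (Fin d)) : Subgroup (TreeAut d) :=
  G ⊓ MulAction.stabilizer (TreeAut d) v

/-- `Stab_G(V)`, the pointwise stabilizer of a set of vertices. -/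
def stabSet {d : ℕ} (G : Subgroup (TreeAut d)) (V : Set (List (Fin d))) :
    Subgroup (TreeAut d) :=
  G ⊓ fixingSubgroup (TreeAut d) V

/-- The `n`-th level stabilizer. -/
def stabLevel {d : ℕ} (G : Subgroup (TreeAut d)) (n : ℕ) : Subgroup (TreeAut d) :=
  stabSet G (level d n)

/-- The rigid stabilizer `Rist_G(v)`: the elements of `G` acting trivially outside `T_v`. -/
def rist {d : ℕ} (G : Subgroup (TreeAut d)) (v : List (Fin d)) : Subgroup (TreeAut d) :=
  stabSet G {w | ¬ v <+: w}

/-- The rigid stabilizer of a level, generated by the rigid stabilizers of its vertices. -/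
def ristLevel {d : ℕ} (G : Subgroup (TreeAut d)) (n : ℕ) : Subgroup (TreeAut d) :=
  ⨆ v ∈ level d n, rist G v

/-- The homomorphism `φ_v : Stab(v) → Aut(T)`. -/
def sectionHom {d : ℕ} (v : List (Fin d)) :
    MulAction.stabilizer (TreeAut d) v →* TreeAut d where
  toFun g := TreeAut.sectionAt (g : TreeAut d) v
  map_one' := by
    ext1 w
    exact List.append_cancel_left (TreeAut.apply_append (1 : TreeAut d) v w).symm
  map_mul' g h := by
    have hh : (h : TreeAut d) v = v := h.2
    ext1 w
    have e := TreeAut.apply_append (g * h : TreeAut d) v w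
    have e2 : (g * h : TreeAut d) (v ++ w) = (g : TreeAut d) ((h : TreeAut d) (v ++ w)) := rfl
    have e3 : (g * h : TreeAut d) v = (g : TreeAut d) ((h : TreeAut d) v) := rfl
    rw [e2, e3, TreeAut.apply_append (h : TreeAut d), hh, TreeAut.apply_append] at e
    exact (List.append_cancel_left e).symm

/-- `φ_v(Stab_K(v))`, the section of the subgroup `K` at `v`. -/
def sectionSubgroup {d : ℕ} (K : Subgroup (TreeAut d)) (v : List (Fin d)) :
    Subgroup (TreeAut d) :=
  (K.subgroupOf (MulAction.stabilizer (TreeAut d) v)).map (sectionHom v)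

theorem mem_sectionSubgroup {d : ℕ} {K : Subgroup (TreeAut d)} {v : List (Fin d)}
    {h : TreeAut d} :
    h ∈ sectionSubgroup K v ↔ ∃ g ∈ stab K v, TreeAut.sectionAt g v = h := by
  constructor
  · rintro ⟨⟨g, hg⟩, hgK, rfl⟩
    exact ⟨g, ⟨hgK, hg⟩, rfl⟩
  · rintro ⟨g, ⟨hgK, hg⟩, rfl⟩
    exact ⟨⟨g, hg⟩, hgK, rfl⟩

end Subgroups

/-- `G` acts transitively on the levels and all rigid stabilizers of vertices are infinite. -/
structure IsWeaklyBranch {d : ℕ} (G : Subgroup (TreeAut d)) : Prop where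
  transitive : ∀ n : ℕ, ∀ v ∈ level d n, ∀ w ∈ level d n, ∃ g ∈ G, g • v = w
  infinite_rist : ∀ v : List (Fin d), Infinite (rist G v)

/-- Branch groups: weakly branch groups all of whose level rigid stabilizers have finite index. -/
structure IsBranch {d : ℕ} (G : Subgroup (TreeAut d)) : Prop extends IsWeaklyBranch G where
  finiteIndex_ristLevel : ∀ n : ℕ, (ristLevel G n).IsFiniteRelIndex G

def IsSelfSimilar {d : ℕ} (G : Subgroup (TreeAut d)) : Prop :=
  ∀ v : List (Fin d), sectionSubgroup G v ≤ G

def IsSelfReplicating {d : ℕ} (G : Subgroup (TreeAut d)) : Prop :=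
  IsSelfSimilar G ∧ ∀ v : List (Fin d), sectionSubgroup G v = G

def IsStronglySelfReplicating {d : ℕ} (G : Subgroup (TreeAut d)) : Prop :=
  IsSelfSimilar G ∧ ∀ n : ℕ, ∀ v ∈ level d n, sectionSubgroup (stabLevel G n) v = G

/-- The congruence subgroup property: every finite index subgroup of `G` contains some level
stabilizer. -/
def HasCongruenceSubgroupProperty {d : ℕ} (G : Subgroup (TreeAut d)) : Prop :=
  ∀ K : Subgroup (TreeAut d), K ≤ G → K.IsFiniteRelIndex G → ∃ n : ℕ, stabLevel G n ≤ K

/-- Inductive classes of subgroups of `G`. -/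
structure IsInductiveClass {d : ℕ} (G : Subgroup (TreeAut d))
    (X : Set (Subgroup (TreeAut d))) : Prop where
  subgroups : ∀ H ∈ X, H ≤ G
  bot_mem : ⊥ ∈ X
  self_mem : G ∈ X
  finiteIndex : ∀ H L : Subgroup (TreeAut d), H ≤ L → L ≤ G → H.IsFiniteRelIndex L →
    (L ∈ X ↔ H ∈ X)
  sections : ∀ H : Subgroup (TreeAut d), H.FG → H ≤ stabLevel G 1 →
    (∀ v ∈ level d 1, sectionSubgroup H v ∈ X) → H ∈ X

/-- The subgroup induction property (for a self-similar group `G`): every inductive class of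
subgroups of `G` contains all finitely generated subgroups of `G`. -/
def HasSubgroupInduction {d : ℕ} (G : Subgroup (TreeAut d)) : Prop :=
  ∀ X : Set (Subgroup (TreeAut d)), IsInductiveClass G X →
    ∀ H : Subgroup (TreeAut d), H ≤ G → H.FG → H ∈ X

/-- Two groups are commensurable if they have isomorphic subgroups of finite index. -/
def GroupCommensurable (A B : Type*) [Group A] [Group B] : Prop :=
  ∃ (A₁ : Subgroup A) (B₁ : Subgroup B), A₁.FiniteIndex ∧ B₁.FiniteIndex ∧ Nonempty (A₁ ≃* B₁)

/-- `Φ_F(A)`: the intersection of all maximal subgroups of finite index of `A`. -/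
def frattiniFinite (A : Type*) [Group A] : Subgroup A :=
  sInf {M | IsCoatom M ∧ M.FiniteIndex}

end RootedTree

/-! Call a subgroup of `G` tame if it is commensurable with a power of `G` and all its finite index
subgroups are closed in the profinite topology of `G`. Both claims rest on the fact that every
finitely generated subgroup is tame (`isTame_of_subgroupInduction`), which holds because the tame
subgroups form an inductive class.

The hard axiom is the passage from sections to the group. If the sections of `K` at level 1 are
tame, then `K` is, up to finite index, a subgroup of a power of `G` all of whose coordinate
projections have finite index (`IsTame.of_forall_coordinate`). Such subgroups are split one
coordinate at a time. The part `N` of `K` supported on one coordinate is normal in a finite index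
subgroup of `G`; in a branch group such an `N` is commensurable with a power of `G`, and `N × C(N)`
has finite index (`hasVirtualComplements`). The reason is that below a vertex moved by `N` the
subgroup `N` contains the derived subgroup of a rigid stabilizer (`commutator_rist_le`), while below
the other vertices of a deep level it acts trivially. For this, derived subgroups of finite index
subgroups must have finite index, which is true because `G` is finitely generated and torsion; both
properties again follow from subgroup induction. Finally `G` is commensurable with `G^d`, so
exponents can be lowered by `d - 1`.

For maximal subgroups, a nontrivial `Φ_F(G)` has finite index, hence contains a level stabilizer.
Nilpotency of Frattini subgroups of finite groups, carried back to `G` by sections, shows that all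
finite quotients of `G` are nilpotent (`hasNilpotentFiniteQuotients`). This passes to a finite index
normal subgroup `C` of `H`. A maximal subgroup of infinite index would contain a finitely generated
`M₀` with `M₀ [C, C] = H`; being closed, `M₀` lies in a proper finite index subgroup, which
nilpotency forbids (`finiteIndex_of_isCoatom`). -/

namespace RootedTree

/-! ### Finite index, expressed as nonvanishing of the index. -/

section RelIndex

variable {A B : Type*} [Group A] [Group B]

theorem relIndex_map_ne_zero (f : A →* B) {H K : Subgroup A} (h : H.relIndex K ≠ 0) :
    (H.map f).relIndex (K.map f) ≠ 0 := by
  rw [← Subgroup.relIndex_comap]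
  exact fun h0 => h (Subgroup.relIndex_eq_zero_of_le_left (Subgroup.le_comap_map f H) h0)

theorem index_map_ne_zero {f : A →* B} (hf : f.range.index ≠ 0) {H : Subgroup A}
    (h : H.index ≠ 0) : (H.map f).index ≠ 0 := by
  rw [Subgroup.index_map]
  exact mul_ne_zero (fun h0 => h (Nat.eq_zero_of_zero_dvd
    (h0 ▸ Subgroup.index_dvd_of_le le_sup_left))) hf

theorem index_comap_ne_zero (f : A →* B) {H : Subgroup B} (h : H.index ≠ 0) :
    (H.comap f).index ≠ 0 := by
  rw [Subgroup.index_comap]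
  exact fun h0 => h (Subgroup.index_eq_zero_of_relIndex_eq_zero h0)

theorem index_ne_zero_of_le {H K : Subgroup A} (hHK : H ≤ K) (h : H.index ≠ 0) :
    K.index ≠ 0 :=
  fun h0 => h (Nat.eq_zero_of_zero_dvd (h0 ▸ Subgroup.index_dvd_of_le hHK))

theorem relIndex_ne_zero_of_le {H K L : Subgroup A} (hHK : H ≤ K) (h : H.relIndex L ≠ 0) :
    K.relIndex L ≠ 0 :=
  fun h0 => h (Subgroup.relIndex_eq_zero_of_le_left hHK h0)

theorem relIndex_ne_zero_of_le_right {H K L : Subgroup A} (hHK : K ≤ L) (h : H.relIndex L ≠ 0) :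
    H.relIndex K ≠ 0 :=
  fun h0 => h (Subgroup.relIndex_eq_zero_of_le_right hHK h0)

theorem relIndex_ne_zero_of_index {H : Subgroup A} (h : H.index ≠ 0) (K : Subgroup A) :
    H.relIndex K ≠ 0 :=
  fun h0 => h (Subgroup.index_eq_zero_of_relIndex_eq_zero h0)

theorem index_ne_zero_of_relIndex {H K : Subgroup A} (h : H.relIndex K ≠ 0) (hK : K.index ≠ 0) :
    H.index ≠ 0 := by
  rw [← Subgroup.relIndex_top_right] at hK ⊢
  exact Subgroup.relIndex_ne_zero_trans h hK

theorem index_pi_ne_zero {ι : Type*} [Finite ι] {H : ι → Subgroup A} (h : ∀ i, (H i).index ≠ 0) :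
    (Subgroup.pi Set.univ H).index ≠ 0 := by
  have := Fintype.ofFinite ι
  rw [Subgroup.index_pi]
  exact Finset.prod_ne_zero_iff.2 fun i _ => h i

end RelIndex

/-! ### Commensurability and direct powers. -/

section Commensurable

universe u

/-- Injective homomorphisms onto a subgroup of finite index. -/
def IsVirtualIso {A B : Type*} [Group A] [Group B] (f : A →* B) : Prop :=
  Function.Injective f ∧ f.range.index ≠ 0

variable {A B C D : Type u} [Group A] [Group B] [Group C] [Group D]

theorem IsVirtualIso.comp {f : A →* B} {g : B →* C} (hg : IsVirtualIso g) (hf : IsVirtualIso f) :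
    IsVirtualIso (g.comp f) := by
  refine ⟨hg.1.comp hf.1, ?_⟩
  rw [MonoidHom.range_comp]
  exact index_map_ne_zero hg.2 hf.2

theorem IsVirtualIso.subtype {H : Subgroup A} (hH : H.index ≠ 0) : IsVirtualIso H.subtype :=
  ⟨H.subtype_injective, by rwa [H.range_subtype]⟩

theorem IsVirtualIso.of_mulEquiv (e : A ≃* B) : IsVirtualIso e.toMonoidHom :=
  ⟨e.injective, by
    rw [MonoidHom.range_eq_top.2 e.surjective, Subgroup.index_top]; exact one_ne_zero⟩

/-- Spans of virtual isomorphisms compose and multiply more easily than pairs of subgroups. -/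
theorem groupCommensurable_iff : GroupCommensurable A B ↔
    ∃ (C : Type u) (_ : Group C) (f : C →* A) (g : C →* B), IsVirtualIso f ∧ IsVirtualIso g := by
  constructor
  · rintro ⟨A₁, B₁, hA, hB, ⟨e⟩⟩
    exact ⟨A₁, inferInstance, A₁.subtype, B₁.subtype.comp e.toMonoidHom,
      IsVirtualIso.subtype hA.index_ne_zero,
      (IsVirtualIso.subtype hB.index_ne_zero).comp (IsVirtualIso.of_mulEquiv e)⟩
  · rintro ⟨C, _, f, g, hf, hg⟩
    exact ⟨f.range, g.range, ⟨hf.2⟩, ⟨hg.2⟩,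
      ⟨(MonoidHom.ofInjective hf.1).symm.trans (MonoidHom.ofInjective hg.1)⟩⟩

theorem IsVirtualIso.groupCommensurable {f : A →* B} (hf : IsVirtualIso f) :
    GroupCommensurable A B :=
  groupCommensurable_iff.2 ⟨A, inferInstance, MonoidHom.id A, f,
    IsVirtualIso.of_mulEquiv (MulEquiv.refl A), hf⟩

theorem GroupCommensurable.of_mulEquiv (e : A ≃* B) : GroupCommensurable A B :=
  (IsVirtualIso.of_mulEquiv e).groupCommensurable

theorem GroupCommensurable.refl (A : Type u) [Group A] : GroupCommensurable A A :=
  .of_mulEquiv (MulEquiv.refl A)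

theorem GroupCommensurable.symm (h : GroupCommensurable A B) : GroupCommensurable B A := by
  obtain ⟨A₁, B₁, hA, hB, ⟨e⟩⟩ := h
  exact ⟨B₁, A₁, hB, hA, ⟨e.symm⟩⟩

theorem GroupCommensurable.trans (h : GroupCommensurable A B) (h' : GroupCommensurable B C) :
    GroupCommensurable A C := by
  obtain ⟨X, _, f, g, hf, hg⟩ := groupCommensurable_iff.1 h
  obtain ⟨Y, _, f', g', hf', hg'⟩ := groupCommensurable_iff.1 h'
  -- The fibre product over `B`: its projections to `X` and `Y` are virtual isomorphisms, since both
  -- legs have finite index image in `B`.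
  let P : Subgroup (X × Y) :=
    (g.comp (MonoidHom.fst X Y)).eqLocus (f'.comp (MonoidHom.snd X Y))
  have key : ∀ p : P, g p.1.1 = f' p.1.2 := fun p => p.2
  have h1 : IsVirtualIso ((MonoidHom.fst X Y).comp P.subtype) := by
    constructor
    · rintro p q hpq
      have h1 : p.1.1 = q.1.1 := hpq
      have h2 : f' p.1.2 = f' q.1.2 := by rw [← key, ← key, h1]
      exact Subtype.ext (Prod.ext h1 (hf'.1 h2))
    · refine index_ne_zero_of_le ?_ (index_comap_ne_zero g hf'.2)
      rintro x ⟨y, hy⟩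
      exact ⟨⟨(x, y), hy.symm⟩, rfl⟩
  have h2 : IsVirtualIso ((MonoidHom.snd X Y).comp P.subtype) := by
    constructor
    · rintro p q hpq
      have h1 : p.1.2 = q.1.2 := hpq
      have h2 : g p.1.1 = g q.1.1 := by rw [key, key, h1]
      exact Subtype.ext (Prod.ext (hg.1 h2) h1)
    · refine index_ne_zero_of_le ?_ (index_comap_ne_zero f' hg.2)
      rintro y ⟨x, hx⟩
      exact ⟨⟨(x, y), hx⟩, rfl⟩
  exact groupCommensurable_iff.2 ⟨P, inferInstance, _, _, hf.comp h1, hg'.comp h2⟩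

theorem GroupCommensurable.prod (h : GroupCommensurable A B) (h' : GroupCommensurable C D) :
    GroupCommensurable (A × C) (B × D) := by
  obtain ⟨X, _, f, g, hf, hg⟩ := groupCommensurable_iff.1 h
  obtain ⟨Y, _, f', g', hf', hg'⟩ := groupCommensurable_iff.1 h'
  have key : ∀ {A C : Type u} [Group A] [Group C] {f : X →* A} {f' : Y →* C},
      IsVirtualIso f → IsVirtualIso f' → IsVirtualIso (f.prodMap f') := by
    intro A C _ _ f f' hf hf'
    refine ⟨Prod.map_injective.2 ⟨hf.1, hf'.1⟩, ?_⟩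
    refine index_ne_zero_of_le (H := f.range.prod f'.range) ?_ ?_
    · rintro ⟨a, c⟩ ⟨⟨x, hx⟩, ⟨y, hy⟩⟩
      exact ⟨(x, y), Prod.ext hx hy⟩
    · rw [Subgroup.index_prod]
      exact mul_ne_zero hf.2 hf'.2
  exact groupCommensurable_iff.2 ⟨X × Y, inferInstance, _, _, key hf hf', key hg hg'⟩

theorem groupCommensurable_of_index_ne_zero {H : Subgroup A} (hH : H.index ≠ 0) :
    GroupCommensurable H A :=
  (IsVirtualIso.subtype hH).groupCommensurable

/-- The group `A` is commensurable with a direct power of `Γ`. -/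
def IsCommensurableToPower (Γ A : Type u) [Group Γ] [Group A] : Prop :=
  ∃ k : ℕ, GroupCommensurable A (Fin k → Γ)

theorem GroupCommensurable.pow_reindex {Γ : Type u} [Group Γ] {ι κ : Type} (e : ι ≃ κ)
    (h : GroupCommensurable A (ι → Γ)) : GroupCommensurable A (κ → Γ) :=
  h.trans (.of_mulEquiv (MulEquiv.arrowCongr e (MulEquiv.refl Γ)))

/-- The power of a sum is the product of the powers. -/
def powSum (Γ : Type u) [Group Γ] (ι κ : Type) : ((ι → Γ) × (κ → Γ)) ≃* (ι ⊕ κ → Γ) where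
  toFun p := Sum.elim p.1 p.2
  invFun f := (f ∘ Sum.inl, f ∘ Sum.inr)
  left_inv p := by simp
  right_inv f := by simp
  map_mul' p q := by
    ext i
    cases i <;> rfl

theorem GroupCommensurable.pow_add {Γ : Type u} [Group Γ] {k l : ℕ}
    (h : GroupCommensurable A (Fin k → Γ)) (h' : GroupCommensurable B (Fin l → Γ)) :
    GroupCommensurable (A × B) (Fin (k + l) → Γ) :=
  ((h.prod h').trans (.of_mulEquiv (powSum Γ (Fin k) (Fin l)))).pow_reindex finSumFinEquiv

theorem IsCommensurableToPower.of_groupCommensurable {Γ : Type u} [Group Γ]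
    (h : GroupCommensurable A B) (hB : IsCommensurableToPower Γ B) :
    IsCommensurableToPower Γ A := by
  obtain ⟨k, hk⟩ := hB
  exact ⟨k, h.trans hk⟩

theorem IsCommensurableToPower.prod {Γ : Type u} [Group Γ] (hA : IsCommensurableToPower Γ A)
    (hB : IsCommensurableToPower Γ B) : IsCommensurableToPower Γ (A × B) := by
  obtain ⟨k, hk⟩ := hA
  obtain ⟨l, hl⟩ := hB
  exact ⟨k + l, hk.pow_add hl⟩

end Commensurable

/-! ### Subgroups closed in the profinite topology. -/

section Separable

/-- Subgroups that are closed in the profinite topology. -/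
def IsSeparable {B : Type*} [Group B] (K : Subgroup B) : Prop :=
  ∀ x ∉ K, ∃ U : Subgroup B, U.index ≠ 0 ∧ K ≤ U ∧ x ∉ U

variable {A B : Type*} [Group A] [Group B]

theorem IsSeparable.of_index_ne_zero {K : Subgroup B} (h : K.index ≠ 0) : IsSeparable K :=
  fun _ hx => ⟨K, h, le_rfl, hx⟩

theorem IsSeparable.comap {K : Subgroup B} (hK : IsSeparable K) (f : A →* B) :
    IsSeparable (K.comap f) := by
  intro x hx
  obtain ⟨U, hU, hKU, hxU⟩ := hK (f x) hx
  exact ⟨U.comap f, index_comap_ne_zero f hU, Subgroup.comap_mono hKU, hxU⟩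

theorem IsSeparable.iInf {ι : Sort*} {K : ι → Subgroup B} (hK : ∀ i, IsSeparable (K i)) :
    IsSeparable (⨅ i, K i) := by
  intro x hx
  rw [Subgroup.mem_iInf] at hx
  push Not at hx
  obtain ⟨i, hi⟩ := hx
  obtain ⟨U, hU, hKU, hxU⟩ := hK i x hi
  exact ⟨U, hU, (iInf_le _ i).trans hKU, hxU⟩

theorem IsSeparable.inf {K L : Subgroup B} (hK : IsSeparable K) (hL : IsSeparable L) :
    IsSeparable (K ⊓ L) := by
  intro x hx
  by_cases hxK : x ∈ K
  · obtain ⟨U, hU, hKU, hxU⟩ := hL x fun h => hx ⟨hxK, h⟩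
    exact ⟨U, hU, inf_le_right.trans hKU, hxU⟩
  · obtain ⟨U, hU, hKU, hxU⟩ := hK x hxK
    exact ⟨U, hU, inf_le_left.trans hKU, hxU⟩

theorem IsSeparable.pi {ι : Type*} {K : ι → Subgroup B} (hK : ∀ i, IsSeparable (K i)) :
    IsSeparable (Subgroup.pi Set.univ K) := by
  have h : Subgroup.pi Set.univ K = ⨅ i, (K i).comap (Pi.evalMonoidHom (fun _ => B) i) := by
    ext x
    simp [Subgroup.mem_pi, Subgroup.mem_iInf]
  rw [h]
  exact IsSeparable.iInf fun i => (hK i).comap _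

/-- A subgroup is separable as soon as a finite index subgroup of it is. -/
theorem IsSeparable.of_relIndex_ne_zero {K₀ K : Subgroup B} (hle : K₀ ≤ K)
    (hfi : K₀.relIndex K ≠ 0) (h : IsSeparable K₀) : IsSeparable K := by
  intro x hx
  have hfin : Finite (K ⧸ K₀.subgroupOf K) := Subgroup.index_ne_zero_iff_finite.1 hfi
  have hmem : ∀ k : K, (k : B)⁻¹ * x ∉ K₀ := fun k hk => hx <| by
    simpa using K.mul_mem k.2 (hle hk)
  choose U hU hKU hxU using fun q : K ⧸ K₀.subgroupOf K => h _ (hmem q.out)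
  let V : Subgroup B := (⨅ q, U q).normalCore
  have hVi : (⨅ q, U q).index ≠ 0 := Subgroup.index_iInf_ne_zero hU
  have : (⨅ q, U q).FiniteIndex := ⟨hVi⟩
  refine ⟨K ⊔ V, index_ne_zero_of_le le_sup_right
    (Subgroup.finiteIndex_normalCore (⨅ q, U q)).index_ne_zero, le_sup_left, fun hmem' => ?_⟩
  obtain ⟨k, hk, v, hv, rfl⟩ := Subgroup.mem_sup_of_normal_right.1 hmem'
  have hv' : v ∈ ⨅ q, U q := Subgroup.normalCore_le _ hv
  let q : K ⧸ K₀.subgroupOf K := QuotientGroup.mk ⟨k, hk⟩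
  have h1 : (q.out)⁻¹ * (⟨k, hk⟩ : K) ∈ K₀.subgroupOf K :=
    QuotientGroup.leftRel_apply.1 (Quotient.exact (Quotient.out_eq q))
  apply hxU q
  have h2 : ((q.out : K) : B)⁻¹ * (k * v) = (((q.out)⁻¹ * (⟨k, hk⟩ : K) : K) : B) * v := by
    simp [mul_assoc]
  rw [h2]
  exact (U q).mul_mem (hKU q h1) ((Subgroup.mem_iInf.1 hv') q)

/-- Subgroups all of whose finite index subgroups are closed in the profinite topology. -/
def IsStronglySeparable {B : Type*} [Group B] (W : Subgroup B) : Prop :=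
  ∀ U ≤ W, U.relIndex W ≠ 0 → IsSeparable U

theorem IsStronglySeparable.isSeparable {W : Subgroup B} (hW : IsStronglySeparable W) :
    IsSeparable W :=
  hW W le_rfl (by simp)

theorem IsStronglySeparable.of_relIndex_ne_zero {W V : Subgroup B} (hW : IsStronglySeparable W)
    (hVW : V ≤ W) (hfi : V.relIndex W ≠ 0) : IsStronglySeparable V :=
  fun U hU hUV => hW U (hU.trans hVW) (Subgroup.relIndex_ne_zero_trans hUV hfi)

theorem IsStronglySeparable.of_finiteIndex_subgroup {W V : Subgroup B}
    (hV : IsStronglySeparable V) (hVW : V ≤ W) (hfi : V.relIndex W ≠ 0) :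
    IsStronglySeparable W := by
  intro U hU hUW
  have h1 : (U ⊓ V).relIndex V ≠ 0 := by
    rw [Subgroup.inf_relIndex_right]
    exact relIndex_ne_zero_of_le_right hVW hUW
  refine IsSeparable.of_relIndex_ne_zero inf_le_left ?_ (hV (U ⊓ V) inf_le_right h1)
  rw [Subgroup.inf_relIndex_left]
  exact relIndex_ne_zero_of_le_right hU hfi

theorem IsStronglySeparable.of_index_ne_zero {W : Subgroup B} (h : W.index ≠ 0) :
    IsStronglySeparable W :=
  fun _ _ hUW => .of_index_ne_zero (index_ne_zero_of_relIndex hUW h)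

/-- A finite index subgroup of `W` that separates a point inside `W` is itself closed in `B`.
Closedness of `W` alone would not give this transitivity. -/
theorem IsStronglySeparable.map_subtype {W : Subgroup B} (hW : IsStronglySeparable W)
    {K : Subgroup W} (hK : IsSeparable K) : IsSeparable (K.map W.subtype) := by
  intro x hx
  by_cases hxW : x ∈ W
  · obtain ⟨U, hU, hKU, hxU⟩ := hK ⟨x, hxW⟩ fun h => hx ⟨_, h, rfl⟩
    have hU' : (U.map W.subtype).relIndex W ≠ 0 := by
      rw [Subgroup.relIndex, Subgroup.subgroupOf,
        Subgroup.comap_map_eq_self_of_injective W.subtype_injective]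
      exact hU
    obtain ⟨U', h1, h2, h3⟩ := hW _ (Subgroup.map_subtype_le U) hU' x (by
      rintro ⟨y, hy, rfl⟩
      exact hxU hy)
    exact ⟨U', h1, (Subgroup.map_mono hKU).trans h2, h3⟩
  · obtain ⟨U, hU, hWU, hxU⟩ := hW.isSeparable x hxW
    exact ⟨U, hU, (Subgroup.map_subtype_le K).trans hWU, hxU⟩

/-- A finite index subgroup of the product contains the product of its intersections with the
factors, which is closed and of finite index. -/
theorem IsStronglySeparable.pi {ι : Type*} [Finite ι] {W : ι → Subgroup B}
    (hW : ∀ i, IsStronglySeparable (W i)) : IsStronglySeparable (Subgroup.pi Set.univ W) := by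
  classical
  intro U hU hfi
  let V : ι → Subgroup B := fun i => U.comap (MonoidHom.mulSingle (fun _ => B) i) ⊓ W i
  have hV : ∀ i, (V i).relIndex (W i) ≠ 0 := fun i => by
    rw [Subgroup.inf_relIndex_right, Subgroup.relIndex_comap]
    refine relIndex_ne_zero_of_le_right ?_ hfi
    rintro _ ⟨w, hw, rfl⟩ j -
    rcases eq_or_ne j i with rfl | hj
    · simpa using hw
    · simp [hj]
  have hVs : IsSeparable (Subgroup.pi Set.univ V) :=
    IsSeparable.pi fun i => hW i _ inf_le_right (hV i)
  have hVU : Subgroup.pi Set.univ V ≤ U := fun x hx =>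
    Subgroup.pi_mem_of_mulSingle_mem x fun i => (hx i trivial).1
  refine hVs.of_relIndex_ne_zero hVU (relIndex_ne_zero_of_le_right hU ?_)
  have h : Subgroup.pi Set.univ V =
      (⨅ i, (V i).comap (Pi.evalMonoidHom (fun _ => B) i)) := by
    ext x
    simp [Subgroup.mem_pi, Subgroup.mem_iInf]
  rw [h]
  refine Subgroup.relIndex_iInf_ne_zero fun i => ?_
  rw [Subgroup.relIndex_comap]
  refine relIndex_ne_zero_of_le_right ?_ (hV i)
  rintro _ ⟨w, hw, rfl⟩
  exact hw i trivial

/-- Failure to commute with a given `s` is visible in a finite quotient, and the centralizer of the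
image of `s` pulls back to a finite index subgroup. -/
theorem isSeparable_centralizer [hB : Group.ResiduallyFinite B] (S : Set B) :
    IsSeparable (Subgroup.centralizer S) := by
  intro x hx
  rw [Subgroup.mem_centralizer_iff] at hx
  push Not at hx
  obtain ⟨s, hs, hsx⟩ := hx
  obtain ⟨N, hN⟩ := Group.exists_finiteIndexNormalSubgroup_notMem (s * x * (x * s)⁻¹)
    (fun h => hsx (mul_inv_eq_one.1 h))
  let q := QuotientGroup.mk' N.toSubgroup
  refine ⟨(Subgroup.centralizer {q s}).comap q, ?_, ?_, ?_⟩
  · have : Finite (B ⧸ N.toSubgroup) := inferInstance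
    exact index_comap_ne_zero q Subgroup.FiniteIndex.index_ne_zero
  · intro y hy
    rw [Subgroup.mem_comap, Subgroup.mem_centralizer_singleton_iff]
    rw [Subgroup.mem_centralizer_iff] at hy
    rw [← map_mul, ← map_mul, hy s hs]
  · intro hxs
    rw [Subgroup.mem_comap, Subgroup.mem_centralizer_singleton_iff] at hxs
    apply hN
    change _ ∈ N.toSubgroup
    rw [← QuotientGroup.ker_mk' N.toSubgroup, MonoidHom.mem_ker]
    change q _ = 1
    rw [map_mul, map_inv, mul_inv_eq_one, map_mul, map_mul, hxs]

end Separable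

/-! ### Subgroups of powers whose coordinate projections have finite index. -/

section Subdirect

theorem exists_mul_of_mem_sup {A : Type*} [Group A] {N D : Subgroup A}
    (h : ∀ n ∈ N, ∀ x ∈ D, n * x = x * n) {x : A} (hx : x ∈ N ⊔ D) :
    ∃ n ∈ N, ∃ y ∈ D, x = n * y := by
  have hr := MonoidHom.noncommCoprod_range N.subtype D.subtype fun n y => h n n.2 y y.2
  rw [Subgroup.range_subtype, Subgroup.range_subtype] at hr
  rw [← hr] at hx
  obtain ⟨⟨n, y⟩, rfl⟩ := hx
  exact ⟨n, n.2, y, y.2, rfl⟩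

/-- Groups in which the subgroups that are normal in a subgroup of finite index are direct factors
up to finite index, and are commensurable with a direct power of the group. -/
structure HasVirtualComplements (Γ : Type) [Group Γ] : Prop where
  inf_centralizer : ∀ L : Subgroup Γ, L.index ≠ 0 → ∀ N ≤ L,
    (∀ l ∈ L, ∀ x ∈ N, l * x * l⁻¹ ∈ N) → N ⊓ Subgroup.centralizer N = ⊥
  sup_centralizer : ∀ L : Subgroup Γ, L.index ≠ 0 → ∀ N ≤ L,
    (∀ l ∈ L, ∀ x ∈ N, l * x * l⁻¹ ∈ N) → (N ⊔ Subgroup.centralizer N).index ≠ 0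
  commensurable : ∀ L : Subgroup Γ, L.index ≠ 0 → ∀ N ≤ L,
    (∀ l ∈ L, ∀ x ∈ N, l * x * l⁻¹ ∈ N) → IsCommensurableToPower Γ N
  centralizer_eq_bot : ∀ P : Subgroup Γ, P.index ≠ 0 →
    Subgroup.centralizer (P : Set Γ) = ⊥

variable {Γ : Type} [Group Γ]

/-- `N` is the intersection of the double centralizer `C(C(N))`, closed as a centralizer, with `N
C(N)`, of finite index: if `n * y` lies in it with `y ∈ C(N)`, then `y` centralizes `N C(N)`, so `y
= 1`. -/
theorem HasVirtualComplements.isSeparable (hΓ : HasVirtualComplements Γ)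
    [Group.ResiduallyFinite Γ] {L N : Subgroup Γ} (hL : L.index ≠ 0) (hNL : N ≤ L)
    (hN : ∀ l ∈ L, ∀ x ∈ N, l * x * l⁻¹ ∈ N) : IsSeparable N := by
  have hcomm : ∀ n ∈ N, ∀ x ∈ Subgroup.centralizer (N : Set Γ), n * x = x * n :=
    fun n hn x hx => Subgroup.mem_centralizer_iff.1 hx n hn
  have h : N = Subgroup.centralizer (Subgroup.centralizer (N : Set Γ) : Set Γ) ⊓
      (N ⊔ Subgroup.centralizer (N : Set Γ)) := by
    refine le_antisymm (le_inf ?_ le_sup_left) ?_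
    · intro n hn
      rw [Subgroup.mem_centralizer_iff]
      exact fun x hx => (hcomm n hn x hx).symm
    · rintro x ⟨hx, hx'⟩
      obtain ⟨n, hn, y, hy, rfl⟩ := exists_mul_of_mem_sup hcomm hx'
      have hy' : y ∈ Subgroup.centralizer ((N ⊔ Subgroup.centralizer (N : Set Γ) :
          Subgroup Γ) : Set Γ) := by
        rw [Subgroup.mem_centralizer_iff]
        intro z hz
        obtain ⟨n', hn', y', hy', rfl⟩ := exists_mul_of_mem_sup hcomm hz
        have h1 : y' * (n * y) = n * y * y' := Subgroup.mem_centralizer_iff.1 hx y' hy'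
        have h2 : y' * y = y * y' := by
          rw [← mul_assoc, ← hcomm n hn y' hy', mul_assoc, mul_assoc] at h1
          exact mul_left_cancel h1
        rw [mul_assoc, h2, ← mul_assoc, hcomm n' hn' y hy, mul_assoc]
      rw [hΓ.centralizer_eq_bot _ (hΓ.sup_centralizer L hL N hNL hN), Subgroup.mem_bot] at hy'
      rwa [hy', mul_one]
  rw [h]
  exact (isSeparable_centralizer _).inf (.of_index_ne_zero (hΓ.sup_centralizer L hL N hNL hN))

/-- The subgroup `H` of a power projects onto subgroups of finite index. -/
def HasVirtuallyFullCoordinates {ι : Type} (H : Subgroup (ι → Γ)) : Prop :=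
  ∀ i, (H.map (Pi.evalMonoidHom (fun _ => Γ) i)).index ≠ 0

theorem HasVirtuallyFullCoordinates.of_relIndex_ne_zero {ι : Type} {H K : Subgroup (ι → Γ)}
    (hH : HasVirtuallyFullCoordinates H) (h : K.relIndex H ≠ 0) :
    HasVirtuallyFullCoordinates K :=
  fun i => index_ne_zero_of_relIndex (relIndex_map_ne_zero _ h) (hH i)

/-- Deletion of the first coordinate. -/
def tailHom (Γ : Type) [Group Γ] (m : ℕ) : (Fin (m + 1) → Γ) →* (Fin m → Γ) where
  toFun x i := x i.succ
  map_one' := rfl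
  map_mul' _ _ := rfl

theorem HasVirtuallyFullCoordinates.tail {m : ℕ} {H : Subgroup (Fin (m + 1) → Γ)}
    (hH : HasVirtuallyFullCoordinates H) : HasVirtuallyFullCoordinates (H.map (tailHom Γ m)) := by
  intro i
  rw [Subgroup.map_map]
  exact hH i.succ

theorem eq_mulSingle_of_tailHom_eq_one {m : ℕ} {x : Fin (m + 1) → Γ} (hx : tailHom Γ m x = 1) :
    x = Pi.mulSingle 0 (x 0) := by
  ext i
  refine Fin.cases (by simp) (fun j => ?_) i
  have : x j.succ = 1 := congrFun hx j
  simp [this]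

theorem tailHom_mulSingle {m : ℕ} (g : Γ) :
    tailHom Γ m (Pi.mulSingle 0 g) = 1 := by
  ext i
  simp [tailHom]

/-- The subgroup of the elements of `H` supported on the first coordinate. -/
def firstFactor {m : ℕ} (H : Subgroup (Fin (m + 1) → Γ)) : Subgroup Γ :=
  H.comap (MonoidHom.mulSingle (fun _ => Γ) 0)

theorem mem_firstFactor {m : ℕ} {H : Subgroup (Fin (m + 1) → Γ)} {g : Γ} :
    g ∈ firstFactor H ↔ Pi.mulSingle 0 g ∈ H := Iff.rfl

theorem conj_mulSingle {m : ℕ} (h : Fin (m + 1) → Γ) (g : Γ) :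
    h * Pi.mulSingle 0 g * h⁻¹ = Pi.mulSingle 0 (h 0 * g * (h 0)⁻¹) := by
  ext i
  refine Fin.cases (by simp) (fun j => ?_) i
  simp

theorem firstFactor_le {m : ℕ} (H : Subgroup (Fin (m + 1) → Γ)) :
    firstFactor H ≤ H.map (Pi.evalMonoidHom (fun _ => Γ) 0) :=
  fun g hg => ⟨Pi.mulSingle 0 g, hg, by simp⟩

theorem conj_mem_firstFactor {m : ℕ} (H : Subgroup (Fin (m + 1) → Γ)) :
    ∀ l ∈ H.map (Pi.evalMonoidHom (fun _ => Γ) 0), ∀ x ∈ firstFactor H,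
      l * x * l⁻¹ ∈ firstFactor H := by
  rintro _ ⟨h, hh, rfl⟩ x hx
  have h1 := H.mul_mem (H.mul_mem hh hx) (H.inv_mem hh)
  rw [MonoidHom.mulSingle_apply, conj_mulSingle] at h1
  exact h1

/-- Up to finite index `H` is `N × C`, where `C` consists of the elements whose first coordinate
centralizes `N`. Deleting that coordinate is injective on `C` because `N ⊓ C(N) = ⊥`, and the image
of `C` has finite index in that of `H`, so the induction hypothesis applies to it. -/
theorem HasVirtualComplements.isCommensurableToPower_fin (hΓ : HasVirtualComplements Γ) (m : ℕ) :
    ∀ H : Subgroup (Fin m → Γ), HasVirtuallyFullCoordinates H →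
      IsCommensurableToPower Γ H := by
  induction m with
  | zero =>
    intro H _
    have : Subsingleton H := inferInstance
    refine ⟨0, .of_mulEquiv ⟨⟨fun _ => 1, fun _ => 1, fun _ => Subsingleton.elim _ _,
      fun _ => Subsingleton.elim _ _⟩, fun _ _ => Subsingleton.elim _ _⟩⟩
  | succ m ih =>
    intro H hH
    set p := Pi.evalMonoidHom (fun _ : Fin (m + 1) => Γ) 0 with hp
    set N := firstFactor H with hN
    set D := Subgroup.centralizer (N : Set Γ) with hD
    have hbot : N ⊓ D = ⊥ :=
      hΓ.inf_centralizer _ (hH 0) N (firstFactor_le H) (conj_mem_firstFactor H)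
    have hsup : (N ⊔ D).index ≠ 0 :=
      hΓ.sup_centralizer _ (hH 0) N (firstFactor_le H) (conj_mem_firstFactor H)
    have hcomm : ∀ n ∈ N, ∀ x ∈ D, n * x = x * n :=
      fun n hn x hx => Subgroup.mem_centralizer_iff.1 hx n hn
    have hNpow := hΓ.commensurable _ (hH 0) N (firstFactor_le H) (conj_mem_firstFactor H)
    let C : Subgroup (Fin (m + 1) → Γ) := H ⊓ D.comap p
    let E : Subgroup (Fin (m + 1) → Γ) := H ⊓ (N ⊔ D).comap p
    have hEdec : ∀ x ∈ E, ∃ n ∈ N, ∃ c ∈ C, x = Pi.mulSingle 0 n * c := by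
      rintro x ⟨hxH, hx⟩
      obtain ⟨n, hn, y, hy, hxy⟩ := exists_mul_of_mem_sup hcomm hx
      refine ⟨n, hn, (Pi.mulSingle 0 n)⁻¹ * x, ⟨H.mul_mem (H.inv_mem (mem_firstFactor.1 hn)) hxH, ?_⟩,
        by simp⟩
      change p _ ∈ D
      have : p ((Pi.mulSingle 0 n)⁻¹ * x) = y := by
        rw [map_mul, map_inv, hxy]
        simp [hp]
      rwa [this]
    have hE : E.relIndex H ≠ 0 := by
      rw [Subgroup.inf_relIndex_left]
      exact relIndex_ne_zero_of_index (index_comap_ne_zero p hsup) H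
    have hmap : E.map (tailHom Γ m) ≤ C.map (tailHom Γ m) := by
      rintro _ ⟨x, hx, rfl⟩
      obtain ⟨n, hn, c, hc, rfl⟩ := hEdec x hx
      exact ⟨c, hc, by rw [map_mul, tailHom_mulSingle, one_mul]⟩
    have hC : (C.map (tailHom Γ m)).relIndex (H.map (tailHom Γ m)) ≠ 0 :=
      relIndex_ne_zero_of_le hmap (relIndex_map_ne_zero _ hE)
    have hCinj : ∀ c ∈ C, tailHom Γ m c = 1 → c = 1 := by
      rintro c ⟨hcH, hcD⟩ hc
      have h1 := eq_mulSingle_of_tailHom_eq_one hc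
      have h2 : c 0 ∈ N := by
        rw [hN, mem_firstFactor, ← h1]
        exact hcH
      have h3 : c 0 ∈ N ⊓ D := ⟨h2, hcD⟩
      rw [hbot, Subgroup.mem_bot] at h3
      rw [h1, h3, Pi.mulSingle_one]
    have hCpow : IsCommensurableToPower Γ C := by
      refine (ih _ ((hH.tail).of_relIndex_ne_zero hC)).of_groupCommensurable ?_
      refine GroupCommensurable.of_mulEquiv (MulEquiv.ofBijective
        ((tailHom Γ m).subgroupMap C) ⟨?_, (tailHom Γ m).subgroupMap_surjective C⟩)
      refine (injective_iff_map_eq_one _).2 fun c hc => ?_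
      exact Subtype.ext (hCinj c c.2 (congrArg Subtype.val hc))
    let f : N →* H := ((MonoidHom.mulSingle (fun _ : Fin (m + 1) => Γ) 0).comp
      N.subtype).codRestrict H fun n => n.2
    let g : C →* H := Subgroup.inclusion inf_le_left
    have hfg : ∀ n c, Commute (f n) (g c) := by
      rintro n c
      apply Subtype.ext
      change Pi.mulSingle 0 (n : Γ) * (c : Fin (m + 1) → Γ) =
        (c : Fin (m + 1) → Γ) * Pi.mulSingle 0 (n : Γ)
      have h1 := conj_mulSingle (c : Fin (m + 1) → Γ) (n : Γ)
      have h2 : (c : Fin (m + 1) → Γ) 0 * n * ((c : Fin (m + 1) → Γ) 0)⁻¹ = n :=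
        mul_inv_eq_iff_eq_mul.2 (hcomm n n.2 _ c.2.2).symm
      rw [h2] at h1
      exact (mul_inv_eq_iff_eq_mul.1 h1).symm
    refine IsCommensurableToPower.of_groupCommensurable (GroupCommensurable.symm
      (IsVirtualIso.groupCommensurable (f := MonoidHom.noncommCoprod f g hfg) ?_))
      (hNpow.prod hCpow)
    constructor
    · refine (injective_iff_map_eq_one _).2 ?_
      rintro ⟨n, c⟩ hnc
      have h1 : Pi.mulSingle 0 (n : Γ) * (c : Fin (m + 1) → Γ) = 1 := congrArg Subtype.val hnc
      have h2 : tailHom Γ m c = 1 := by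
        have := congrArg (tailHom Γ m) h1
        rwa [map_mul, tailHom_mulSingle, one_mul, map_one] at this
      have h3 := hCinj c c.2 h2
      rw [h3, mul_one, Pi.mulSingle_eq_one_iff] at h1
      exact Prod.ext (Subtype.ext h1) (Subtype.ext h3)
    · refine index_ne_zero_of_le (H := E.subgroupOf H) ?_ hE
      intro x hx
      obtain ⟨n, hn, c, hc, hxnc⟩ := hEdec x hx
      exact ⟨(⟨n, hn⟩, ⟨c, hc⟩), Subtype.ext hxnc.symm⟩

/-- The core is taken in `L` rather than in `A`, because only conjugation by `L` is known to
preserve `N`. -/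
theorem exists_index_ne_zero_conj_mem {A : Type*} [Group A] {L N U₀ : Subgroup A}
    (hL : L.index ≠ 0) (hU₀ : U₀.index ≠ 0) (hNL : N ≤ L) (hNU₀ : N ≤ U₀)
    (hN : ∀ l ∈ L, ∀ x ∈ N, l * x * l⁻¹ ∈ N) :
    ∃ U : Subgroup A, U.index ≠ 0 ∧ U ≤ U₀ ∧ N ≤ U ∧ ∀ l ∈ L, ∀ y ∈ U, l * y * l⁻¹ ∈ U := by
  refine ⟨((U₀.subgroupOf L).normalCore).map L.subtype, ?_, ?_, ?_, ?_⟩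
  · have h0 : (U₀.subgroupOf L).FiniteIndex := ⟨relIndex_ne_zero_of_index hU₀ L⟩
    rw [Subgroup.index_map_subtype]
    exact mul_ne_zero (Subgroup.finiteIndex_normalCore _).index_ne_zero hL
  · rintro _ ⟨y, hy, rfl⟩
    exact Subgroup.normalCore_le (U₀.subgroupOf L) hy
  · intro n hn
    refine ⟨⟨n, hNL hn⟩, fun l => ?_, rfl⟩
    exact hNU₀ (hN l l.2 n hn)
  · rintro l hl _ ⟨y, hy, rfl⟩
    exact ⟨⟨l, hl⟩ * y * ⟨l, hl⟩⁻¹, Subgroup.Normal.conj_mem inferInstance y hy _, rfl⟩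

/-- In the essential case `x` differs from an element of `H` by some `g ∉ N` in the first
coordinate. An `L`-invariant finite index `U ≥ N` avoiding `g` thickens `H` to `V = H U`, which
still misses `x`. It is closed because, up to finite index, it is a product of `U` with a subgroup
covered by induction. -/
theorem HasVirtualComplements.isSeparable_fin (hΓ : HasVirtualComplements Γ)
    [Group.ResiduallyFinite Γ] (m : ℕ) :
    ∀ H : Subgroup (Fin m → Γ), HasVirtuallyFullCoordinates H → IsSeparable H := by
  induction m with
  | zero =>
    intro H _ x hx
    exact absurd (Subsingleton.elim 1 x ▸ H.one_mem) hx
  | succ m ih =>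
    intro H hH x hx
    set p := Pi.evalMonoidHom (fun _ : Fin (m + 1) => Γ) 0 with hp
    set N := firstFactor H with hN
    set L := H.map p with hL
    set Q := H.map (tailHom Γ m) with hQ
    by_cases hxQ : tailHom Γ m x ∈ Q
    swap
    · obtain ⟨U, hU, hQU, hxU⟩ := ih Q hH.tail _ hxQ
      exact ⟨U.comap (tailHom Γ m), index_comap_ne_zero _ hU, Subgroup.map_le_iff_le_comap.1 hQU,
        hxU⟩
    by_cases hxL : p x ∈ L
    swap
    · exact ⟨L.comap p, index_comap_ne_zero _ (hH 0), Subgroup.le_comap_map p H, hxL⟩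
    obtain ⟨h, hh, hhx⟩ := hxQ
    let g : Γ := (p h)⁻¹ * p x
    have hxg : x = h * Pi.mulSingle 0 g := by
      have h1 : tailHom Γ m (h⁻¹ * x) = 1 := by rw [map_mul, map_inv, hhx, inv_mul_cancel]
      have h2 := eq_mulSingle_of_tailHom_eq_one h1
      rw [← inv_mul_eq_iff_eq_mul, h2]
      rfl
    have hgL : g ∈ L := L.mul_mem (L.inv_mem ⟨h, hh, rfl⟩) hxL
    have hgN : g ∉ N := fun hg => hx (hxg ▸ H.mul_mem hh hg)
    obtain ⟨U₀, hU₀, hNU₀, hgU₀⟩ :=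
      hΓ.isSeparable (hH 0) (firstFactor_le H) (conj_mem_firstFactor H) g hgN
    obtain ⟨U, hUi, hUU₀, hNU, hUconj⟩ := exists_index_ne_zero_conj_mem (hH 0) hU₀
      (firstFactor_le H) hNU₀ (conj_mem_firstFactor H)
    -- Closed under products because the first coordinates of elements of `H` normalize `U`.
    let V : Subgroup (Fin (m + 1) → Γ) :=
      { carrier := {y | ∃ h ∈ H, ∃ u ∈ U, y = h * Pi.mulSingle 0 u}
        one_mem' := ⟨1, H.one_mem, 1, U.one_mem, by simp⟩
        mul_mem' := by
          rintro _ _ ⟨h, hh, u, hu, rfl⟩ ⟨h', hh', u', hu', rfl⟩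
          refine ⟨h * h', H.mul_mem hh hh', (h'⁻¹) 0 * u * ((h'⁻¹) 0)⁻¹ * u',
            U.mul_mem (hUconj _ ⟨h'⁻¹, H.inv_mem hh', rfl⟩ u hu) hu', ?_⟩
          rw [Pi.mulSingle_mul, ← conj_mulSingle]
          group
        inv_mem' := by
          rintro _ ⟨h, hh, u, hu, rfl⟩
          refine ⟨h⁻¹, H.inv_mem hh, h 0 * u⁻¹ * (h 0)⁻¹,
            hUconj _ ⟨h, hh, rfl⟩ _ (U.inv_mem hu), ?_⟩
          rw [← conj_mulSingle, Pi.mulSingle_inv]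
          group }
    have hHV : H ≤ V := fun h hh => ⟨h, hh, 1, U.one_mem, by simp⟩
    have hxV : x ∉ V := by
      rintro ⟨h', hh', u, hu, hxu⟩
      have h1 : Pi.mulSingle 0 (g * u⁻¹) ∈ H := by
        have : (Pi.mulSingle 0 (g * u⁻¹) : Fin (m + 1) → Γ) = h⁻¹ * h' := by
          rw [Pi.mulSingle_mul, Pi.mulSingle_inv, mul_inv_eq_iff_eq_mul, mul_assoc, ← hxu,
            hxg, inv_mul_cancel_left]
        rw [this]
        exact H.mul_mem (H.inv_mem hh) hh'
      have h2 : g = (g * u⁻¹) * u := by simp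
      exact hgU₀ (hUU₀ (h2 ▸ U.mul_mem (hNU h1) hu))
    -- Restricting to elements of `H` with first coordinate in `U` makes the full product `U × Q₁`,
    -- called `W` below, lie in `V`.
    let Q₁ := (H ⊓ U.comap p).map (tailHom Γ m)
    have hQ₁ : Q₁.relIndex Q ≠ 0 := by
      refine relIndex_map_ne_zero _ ?_
      rw [Subgroup.inf_relIndex_left]
      exact relIndex_ne_zero_of_index (index_comap_ne_zero p hUi) H
    let W := Q₁.comap (tailHom Γ m) ⊓ U.comap p
    have hWsep : IsSeparable W :=
      ((ih Q₁ (hH.tail.of_relIndex_ne_zero hQ₁)).comap _).inf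
        ((IsSeparable.of_index_ne_zero hUi).comap p)
    have hWV : W ≤ V := by
      rintro y ⟨⟨h', ⟨hh', hhU'⟩, hy⟩, hyU⟩
      refine ⟨h', hh', (h'⁻¹ * y) 0, U.mul_mem (U.inv_mem hhU') hyU, ?_⟩
      have h1 : tailHom Γ m (h'⁻¹ * y) = 1 := by rw [map_mul, map_inv, hy, inv_mul_cancel]
      rw [← inv_mul_eq_iff_eq_mul]
      exact eq_mulSingle_of_tailHom_eq_one h1
    have hWV' : W.relIndex V ≠ 0 := by
      have hVQ : V ≤ Q.comap (tailHom Γ m) := by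
        rintro _ ⟨h', hh', u, hu, rfl⟩
        refine ⟨h', hh', ?_⟩
        rw [map_mul, tailHom_mulSingle, mul_one]
      refine Subgroup.relIndex_inf_ne_zero ?_
        (relIndex_ne_zero_of_index (index_comap_ne_zero p hUi) V)
      exact relIndex_ne_zero_of_le_right hVQ (Subgroup.relIndex_comap_ne_zero _ hQ₁)
    obtain ⟨V', h1, h2, h3⟩ := hWsep.of_relIndex_ne_zero hWV hWV' x hxV
    exact ⟨V', h1, hHV.trans h2, h3⟩

theorem HasVirtuallyFullCoordinates.reindex {ι κ : Type} (e : ι ≃ κ) {H : Subgroup (ι → Γ)}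
    (hH : HasVirtuallyFullCoordinates H) :
    HasVirtuallyFullCoordinates
      (H.map (MulEquiv.arrowCongr e (MulEquiv.refl Γ) : (ι → Γ) ≃* (κ → Γ)).toMonoidHom) := by
  intro i
  rw [Subgroup.map_map]
  exact hH (e.symm i)

theorem HasVirtualComplements.isCommensurableToPower (hΓ : HasVirtualComplements Γ)
    {ι : Type} [Finite ι] {H : Subgroup (ι → Γ)} (hH : HasVirtuallyFullCoordinates H) :
    IsCommensurableToPower Γ H := by
  obtain ⟨n, ⟨e⟩⟩ := Finite.exists_equiv_fin ι
  exact (hΓ.isCommensurableToPower_fin n _ (hH.reindex e)).of_groupCommensurable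
    (.of_mulEquiv (H.equivMapOfInjective _ (MulEquiv.injective _)))

theorem HasVirtualComplements.isSeparable_of_virtuallyFullCoordinates
    (hΓ : HasVirtualComplements Γ) [Group.ResiduallyFinite Γ] {ι : Type} [Finite ι]
    {H : Subgroup (ι → Γ)} (hH : HasVirtuallyFullCoordinates H) : IsSeparable H := by
  obtain ⟨n, ⟨e⟩⟩ := Finite.exists_equiv_fin ι
  have h := (hΓ.isSeparable_fin n _ (hH.reindex e)).comap
    (MulEquiv.arrowCongr e (MulEquiv.refl Γ) : (ι → Γ) ≃* (Fin n → Γ)).toMonoidHom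
  rwa [Subgroup.comap_map_eq_self_of_injective (MulEquiv.injective _)] at h

end Subdirect

/-! ### Rigid stabilizers and the commutator trick. -/

section Rigid

variable {d : ℕ}

theorem TreeAut.mul_apply (g h : TreeAut d) (v : List (Fin d)) : (g * h) v = g (h v) := rfl

theorem TreeAut.inv_apply_self (g : TreeAut d) (v : List (Fin d)) : g⁻¹ (g v) = v :=
  RelIso.symm_apply_apply g v

theorem TreeAut.apply_inv_self (g : TreeAut d) (v : List (Fin d)) : g (g⁻¹ v) = v :=
  RelIso.apply_symm_apply g v

theorem TreeAut.inv_apply_eq {g : TreeAut d} {v w : List (Fin d)} (h : g v = w) : g⁻¹ w = v := by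
  rw [← h, g.inv_apply_self]

theorem TreeAut.prefix_apply_iff (g : TreeAut d) (v w : List (Fin d)) :
    v <+: g w ↔ g⁻¹ v <+: w := by
  rw [← g.prefix_iff (g⁻¹ v), g.apply_inv_self]

theorem exists_apply_ne {g : TreeAut d} (hg : g ≠ 1) : ∃ v, g v ≠ v := by
  by_contra h
  push Not at h
  exact hg (RelIso.ext h)

theorem mem_stabSet {G : Subgroup (TreeAut d)} {V : Set (List (Fin d))} {g : TreeAut d} :
    g ∈ stabSet G V ↔ g ∈ G ∧ ∀ v ∈ V, g v = v := by
  rw [stabSet, Subgroup.mem_inf, mem_fixingSubgroup_iff]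
  rfl

theorem mem_stabLevel {G : Subgroup (TreeAut d)} {n : ℕ} {g : TreeAut d} :
    g ∈ stabLevel G n ↔ g ∈ G ∧ ∀ v : List (Fin d), v.length = n → g v = v :=
  mem_stabSet

theorem mem_rist {G : Subgroup (TreeAut d)} {v : List (Fin d)} {g : TreeAut d} :
    g ∈ rist G v ↔ g ∈ G ∧ ∀ w, ¬ v <+: w → g w = w :=
  mem_stabSet

theorem rist_le (G : Subgroup (TreeAut d)) (v : List (Fin d)) : rist G v ≤ G := inf_le_left

theorem rist_mono {G K : Subgroup (TreeAut d)} (h : G ≤ K) (v : List (Fin d)) :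
    rist G v ≤ rist K v :=
  inf_le_inf_right _ h

theorem eq_of_prefix_of_prefix {u v w : List (Fin d)} (hv : v <+: u) (hw : w <+: u)
    (h : v.length = w.length) : v = w :=
  (List.prefix_of_prefix_length_le hv hw h.le).eq_of_length h

theorem rist_apply_self {G : Subgroup (TreeAut d)} {v : List (Fin d)} {g : TreeAut d}
    (hg : g ∈ rist G v) : g v = v := by
  by_contra h
  have h1 : ¬ v <+: g v := fun hp => h (hp.eq_of_length (g.length_eq v).symm).symm
  exact h (g.injective ((mem_rist.1 hg).2 _ h1))

theorem rist_apply_of_length {G : Subgroup (TreeAut d)} {v w : List (Fin d)} {g : TreeAut d}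
    (hg : g ∈ rist G v) (h : w.length = v.length) : g w = w := by
  by_cases hw : v <+: w
  · rw [← hw.eq_of_length h.symm, rist_apply_self hg]
  · exact (mem_rist.1 hg).2 w hw

theorem rist_prefix_apply {G : Subgroup (TreeAut d)} {v w : List (Fin d)} {g : TreeAut d}
    (hg : g ∈ rist G v) : v <+: g w ↔ v <+: w := by
  rw [g.prefix_apply_iff, TreeAut.inv_apply_eq (rist_apply_self hg)]

theorem conj_mem_rist {G : Subgroup (TreeAut d)} {v : List (Fin d)} {g x : TreeAut d}
    (hg : g ∈ G) (hx : x ∈ rist G v) : g * x * g⁻¹ ∈ rist G (g v) := by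
  refine mem_rist.2 ⟨G.mul_mem (G.mul_mem hg (rist_le G v hx)) (G.inv_mem hg), fun w hw => ?_⟩
  rw [TreeAut.mul_apply, TreeAut.mul_apply, (mem_rist.1 hx).2, g.apply_inv_self]
  intro hv
  apply hw
  rwa [← g⁻¹.prefix_iff, g.inv_apply_self]

/-- Elements of rigid stabilizers of incomparable vertices commute. -/
theorem rist_commute {G : Subgroup (TreeAut d)} {v w : List (Fin d)} {x y : TreeAut d}
    (hvw : ∀ u, v <+: u → ¬ w <+: u) (hx : x ∈ rist G v) (hy : y ∈ rist G w) :
    x * y = y * x := by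
  apply RelIso.ext
  intro u
  change x (y u) = y (x u)
  by_cases hu : v <+: u
  · rw [(mem_rist.1 hy).2 u (hvw u hu),
      (mem_rist.1 hy).2 _ (hvw _ ((rist_prefix_apply hx).2 hu))]
  · rw [(mem_rist.1 hx).2 u hu]
    by_cases hw : w <+: u
    · exact (mem_rist.1 hx).2 _ fun h => hvw _ h ((rist_prefix_apply hy).2 hw)
    · rw [(mem_rist.1 hy).2 u hw, (mem_rist.1 hx).2 u hu]

theorem rist_commute_of_length {G : Subgroup (TreeAut d)} {v w : List (Fin d)} {x y : TreeAut d}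
    (hl : v.length = w.length) (hvw : v ≠ w) (hx : x ∈ rist G v) (hy : y ∈ rist G w) :
    x * y = y * x :=
  rist_commute (fun _ h1 h2 => hvw (eq_of_prefix_of_prefix h1 h2 hl)) hx hy

/-- A subgroup normalised by `L` that moves the vertex `v` contains the derived subgroup of the
rigid stabilizer of `v` in `L`. -/
theorem commutator_rist_le {L N : Subgroup (TreeAut d)} (hNL : N ≤ L)
    (hN : ∀ l ∈ L, ∀ x ∈ N, l * x * l⁻¹ ∈ N) {v : List (Fin d)} {g : TreeAut d} (hg : g ∈ N)
    (hgv : g v ≠ v) : ⁅rist L v, rist L v⁆ ≤ N := by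
  rw [Subgroup.commutator_le]
  intro a ha b hb
  have ha' := (rist L v).inv_mem ha
  -- The conjugate `c = g a⁻¹ g⁻¹` is supported below `g v ≠ v`, so it commutes with `rist L v`.
  -- Hence `c a = [g, a⁻¹] ∈ N` satisfies `[c a, b] = [a, b]`.
  have hc : ∀ z ∈ rist L v, (g * a⁻¹ * g⁻¹) * z = z * (g * a⁻¹ * g⁻¹) := fun z hz =>
    rist_commute_of_length (g.length_eq v) hgv (conj_mem_rist (hNL hg) ha') hz
  have hL : ∀ z ∈ rist L v, z ∈ L := fun z hz => rist_le L v hz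
  have h1 : g * a⁻¹ * g⁻¹ * a ∈ N := by
    have h := N.mul_mem hg (hN a⁻¹ (hL _ ha') g⁻¹ (N.inv_mem hg))
    rwa [inv_inv, ← mul_assoc, ← mul_assoc] at h
  have h2 := N.mul_mem h1 (hN b (hL _ hb) _ (N.inv_mem h1))
  have h3 : g * a⁻¹ * g⁻¹ * a * (b * (g * a⁻¹ * g⁻¹ * a)⁻¹ * b⁻¹) = a * b * a⁻¹ * b⁻¹ := by
    generalize g * a⁻¹ * g⁻¹ = c at hc
    rw [hc a ha, mul_inv_rev]
    have h5 : b * c⁻¹ = c⁻¹ * b := by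
      rw [eq_inv_mul_iff_mul_eq, ← mul_assoc, hc b hb, mul_inv_cancel_right]
    calc a * c * (b * (c⁻¹ * a⁻¹) * b⁻¹) = a * c * (b * c⁻¹) * a⁻¹ * b⁻¹ := by group
      _ = a * b * a⁻¹ * b⁻¹ := by rw [h5]; group
  rwa [h3] at h2

end Rigid

/-! ### The embedding of a level stabilizer into a product by sections. -/

section LevelSections

variable {d : ℕ}

instance (n : ℕ) : Finite (level d n) := (List.finite_length_eq (Fin d) n).to_subtype

theorem card_level_one : Nat.card (level d 1) = d := by
  have e : Fin d ≃ level d 1 :=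
    { toFun := fun i => ⟨[i], rfl⟩
      invFun := fun v => v.1.head (by
        intro h
        have h1 : v.1.length = 1 := v.2
        simp [h] at h1)
      left_inv := fun i => rfl
      right_inv := fun v => by
        obtain ⟨v, hv⟩ := v
        obtain ⟨i, rfl⟩ := List.length_eq_one_iff.1 hv
        rfl }
  rw [← Nat.card_congr e, Nat.card_fin]

theorem mem_stabilizer_of_mem_stabLevel {n : ℕ} (g : stabLevel (⊤ : Subgroup (TreeAut d)) n)
    (v : level d n) : (g : TreeAut d) ∈ MulAction.stabilizer (TreeAut d) (v : List (Fin d)) :=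
  (mem_stabLevel.1 g.2).2 v v.2

/-- The homomorphism `Stab(𝓛_n) → ∏_v Aut(T)` given by the sections at the vertices of level
`n`. -/
def levelSections (d n : ℕ) :
    stabLevel (⊤ : Subgroup (TreeAut d)) n →* (level d n → TreeAut d) where
  toFun g v := sectionHom v.1 ⟨g, mem_stabilizer_of_mem_stabLevel g v⟩
  map_one' := by
    ext1 v
    exact map_one (sectionHom v.1)
  map_mul' g h := by
    ext1 v
    exact map_mul (sectionHom v.1) ⟨g, mem_stabilizer_of_mem_stabLevel g v⟩
      ⟨h, mem_stabilizer_of_mem_stabLevel h v⟩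

theorem levelSections_apply {n : ℕ} (g : stabLevel (⊤ : Subgroup (TreeAut d)) n)
    (v : level d n) : levelSections d n g v = TreeAut.sectionAt (g : TreeAut d) v := rfl

theorem sectionAt_apply_of_fixed {g : TreeAut d} {v : List (Fin d)} (hg : g v = v)
    (w : List (Fin d)) : v ++ g.sectionAt v w = g (v ++ w) := by
  conv_lhs => rw [← hg, hg]
  rw [TreeAut.apply_append, hg]

theorem sectionAt_eq_one_iff {g : TreeAut d} {v : List (Fin d)} (hg : g v = v) :
    g.sectionAt v = 1 ↔ ∀ w, v <+: w → g w = w := by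
  constructor
  · rintro h _ ⟨w, rfl⟩
    rw [← sectionAt_apply_of_fixed hg, h]
    rfl
  · intro h
    apply RelIso.ext
    intro w
    have := sectionAt_apply_of_fixed hg w
    rw [h _ (List.prefix_append v w)] at this
    exact List.append_cancel_left this

theorem eq_one_of_sectionAt_eq_one {n : ℕ} {g : TreeAut d}
    (hg : ∀ v : List (Fin d), v.length = n → g v = v)
    (h : ∀ v : List (Fin d), v.length = n → g.sectionAt v = 1) : g = 1 := by
  apply RelIso.ext
  intro w
  change g w = w
  rcases le_total n w.length with hn | hn
  · have hl : (w.take n).length = n := by simp [hn]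
    exact (sectionAt_eq_one_iff (hg _ hl)).1 (h _ hl) w (List.take_prefix n w)
  · rcases hn.eq_or_lt with hn | hn
    · exact hg w hn
    -- A vertex above level `n` is a prefix of a vertex of level `n`, unless the alphabet is empty;
    -- then the root is the only vertex.
    · have hd : w = [] ∨ 0 < d := by
        rcases w with _ | ⟨a, w⟩
        · exact Or.inl rfl
        · exact Or.inr a.pos
      rcases hd with rfl | hd
      · exact List.eq_nil_of_length_eq_zero (g.length_eq [])
      · let u := w ++ List.replicate (n - w.length) (⟨0, hd⟩ : Fin d)
        have hu : u.length = n := by simp [u]; omega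
        have h1 : g w <+: u := by
          rw [← hg u hu]
          exact (g.prefix_iff _ _).2 (List.prefix_append _ _)
        exact eq_of_prefix_of_prefix h1 (List.prefix_append _ _) (g.length_eq w)

theorem levelSections_injective (n : ℕ) : Function.Injective (levelSections d n) := by
  refine (injective_iff_map_eq_one _).2 fun g hg => Subtype.ext ?_
  exact eq_one_of_sectionAt_eq_one (mem_stabLevel.1 g.2).2 fun v hv => congrFun hg ⟨v, hv⟩

theorem rist_le_stabLevel (G : Subgroup (TreeAut d)) (v : List (Fin d)) :
    rist G v ≤ stabLevel G v.length := fun _ hg =>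
  mem_stabLevel.2 ⟨rist_le G v hg, fun _ hw => rist_apply_of_length hg hw⟩

theorem levelSections_rist {n : ℕ} [DecidableEq (level d n)] {G : Subgroup (TreeAut d)}
    {v : level d n} {g : TreeAut d} (hg : g ∈ rist G v.1)
    (hg' : g ∈ stabLevel (⊤ : Subgroup (TreeAut d)) n) :
    levelSections d n ⟨g, hg'⟩ = Pi.mulSingle v (g.sectionAt v) := by
  ext1 w
  rcases eq_or_ne w v with rfl | hwv
  · rw [Pi.mulSingle_eq_same]
    rfl
  · rw [Pi.mulSingle_eq_of_ne hwv, levelSections_apply]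
    refine (sectionAt_eq_one_iff ((mem_stabLevel.1 hg').2 w w.2)).2 fun u hu => ?_
    refine (mem_rist.1 hg).2 u fun hv => hwv (Subtype.ext ?_)
    exact eq_of_prefix_of_prefix hu hv (w.2.trans v.2.symm)

end LevelSections

/-! ### Finite index subgroups of branch groups and the subgroups they normalize. -/

section Branch

variable {d : ℕ}

theorem TreeAut.take_apply (g : TreeAut d) (v : List (Fin d)) (n : ℕ) :
    g (v.take n) = (g v).take n := by
  rcases le_total n v.length with h | h
  · have h1 : g (v.take n) <+: g v := (g.prefix_iff _ _).2 (List.take_prefix n v)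
    refine eq_of_prefix_of_prefix h1 (List.take_prefix n _) ?_
    rw [g.length_eq, List.length_take, List.length_take, g.length_eq]
  · rw [List.take_of_length_le h, List.take_of_length_le (by rwa [g.length_eq])]

theorem index_stabilizer_ne_zero (v : List (Fin d)) :
    (MulAction.stabilizer (TreeAut d) v).index ≠ 0 := by
  rw [MulAction.index_stabilizer]
  have hsub : MulAction.orbit (TreeAut d) v ⊆ level d v.length := by
    rintro _ ⟨g, rfl⟩
    exact g.length_eq v
  have hfin : (MulAction.orbit (TreeAut d) v).Finite :=
    (List.finite_length_eq (Fin d) v.length).subset hsub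
  exact (Set.ncard_pos hfin).2 ⟨v, MulAction.mem_orbit_self v⟩ |>.ne'

theorem stabLevel_top_index_ne_zero (d n : ℕ) :
    (stabLevel (⊤ : Subgroup (TreeAut d)) n).index ≠ 0 := by
  have h : (⨅ v : level d n, MulAction.stabilizer (TreeAut d) (v : List (Fin d))) ≤
      stabLevel (⊤ : Subgroup (TreeAut d)) n := by
    intro g hg
    rw [Subgroup.mem_iInf] at hg
    exact mem_stabLevel.2 ⟨trivial, fun v hv => hg ⟨v, hv⟩⟩
  exact index_ne_zero_of_le h (Subgroup.index_iInf_ne_zero fun v => index_stabilizer_ne_zero _)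

theorem stabLevel_eq_inf (G : Subgroup (TreeAut d)) (n : ℕ) :
    stabLevel G n = G ⊓ stabLevel ⊤ n := by
  ext g
  rw [Subgroup.mem_inf, mem_stabLevel, mem_stabLevel]
  simp

theorem stabLevel_relIndex_ne_zero (G : Subgroup (TreeAut d)) (n : ℕ) :
    (stabLevel G n).relIndex G ≠ 0 := by
  rw [stabLevel_eq_inf, Subgroup.inf_relIndex_left]
  exact relIndex_ne_zero_of_index (stabLevel_top_index_ne_zero d n) G

theorem sectionSubgroup_mono {K L : Subgroup (TreeAut d)} (h : K ≤ L) (v : List (Fin d)) :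
    sectionSubgroup K v ≤ sectionSubgroup L v :=
  Subgroup.map_mono (Subgroup.comap_mono h)

theorem sectionSubgroup_relIndex_ne_zero {K L : Subgroup (TreeAut d)} (h : K.relIndex L ≠ 0)
    (v : List (Fin d)) : (sectionSubgroup K v).relIndex (sectionSubgroup L v) ≠ 0 :=
  relIndex_map_ne_zero _ (Subgroup.relIndex_comap_ne_zero _ h)

theorem sectionAt_mem_sectionSubgroup {K : Subgroup (TreeAut d)} {v : List (Fin d)}
    {g : TreeAut d} (hg : g ∈ K) (hv : g v = v) : g.sectionAt v ∈ sectionSubgroup K v :=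
  mem_sectionSubgroup.2 ⟨g, ⟨hg, hv⟩, rfl⟩

/-- The rigid stabilizers of the other vertices of level `n` have trivial sections at `v`. -/
theorem sectionSubgroup_ristLevel_le (G : Subgroup (TreeAut d)) {n : ℕ} {v : List (Fin d)}
    (hv : v.length = n) : sectionSubgroup (ristLevel G n) v ≤ sectionSubgroup (rist G v) v := by
  classical
  let S : Subgroup (TreeAut d) := ((sectionSubgroup (rist G v) v).comap
    ((Pi.evalMonoidHom (fun _ => TreeAut d) (⟨v, hv⟩ : level d n)).comp
      (levelSections d n))).map (stabLevel ⊤ n).subtype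
  have hS : ristLevel G n ≤ S := by
    refine iSup₂_le fun w hw g hg => ?_
    have hw' : w.length = n := hw
    have hg' : g ∈ stabLevel (⊤ : Subgroup (TreeAut d)) n :=
      hw' ▸ rist_le_stabLevel ⊤ w (rist_mono le_top w hg)
    refine ⟨⟨g, hg'⟩, ?_, rfl⟩
    change levelSections d n ⟨g, hg'⟩ ⟨v, hv⟩ ∈ sectionSubgroup (rist G v) v
    rw [levelSections_rist (v := ⟨w, hw⟩) hg hg']
    rcases eq_or_ne w v with rfl | hwv
    · rw [Pi.mulSingle_eq_same]
      exact sectionAt_mem_sectionSubgroup hg (rist_apply_self hg)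
    · rw [Pi.mulSingle_eq_of_ne (fun h => hwv (congrArg Subtype.val h).symm)]
      exact one_mem _
  intro x hx
  obtain ⟨g, ⟨hg, -⟩, rfl⟩ := mem_sectionSubgroup.1 hx
  obtain ⟨g', hg', rfl⟩ := hS hg
  exact hg'

variable {G : Subgroup (TreeAut d)}

theorem sectionSubgroup_rist_relIndex_ne_zero (hrep : IsSelfReplicating G) (hb : IsBranch G)
    {L : Subgroup (TreeAut d)} (hL : L.relIndex G ≠ 0) (v : List (Fin d)) :
    (sectionSubgroup (rist L v) v).relIndex G ≠ 0 := by
  have h1 : (rist L v).relIndex (rist G v) ≠ 0 := Subgroup.relIndex_inter_ne_zero hL _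
  refine Subgroup.relIndex_ne_zero_trans (sectionSubgroup_relIndex_ne_zero h1 v) ?_
  refine relIndex_ne_zero_of_le (sectionSubgroup_ristLevel_le G rfl) ?_
  have h2 := sectionSubgroup_relIndex_ne_zero
    (hb.finiteIndex_ristLevel v.length).relIndex_ne_zero v
  rwa [hrep.2 v] at h2

theorem rist_ne_bot_of_relIndex_ne_zero (hb : IsWeaklyBranch G) {P : Subgroup (TreeAut d)}
    (hP : P.relIndex G ≠ 0) (v : List (Fin d)) : ∃ y ∈ rist G v, y ∈ P ∧ y ≠ 1 := by
  by_contra h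
  push Not at h
  have h1 : P.relIndex (rist G v) ≠ 0 := relIndex_ne_zero_of_le_right (rist_le G v) hP
  rw [← Subgroup.inf_relIndex_right] at h1
  have h2 : P ⊓ rist G v = ⊥ := by
    rw [eq_bot_iff]
    exact fun y hy => h y hy.2 hy.1
  rw [h2, Subgroup.relIndex_bot_left] at h1
  exact h1 (@Nat.card_eq_zero_of_infinite _ (hb.infinite_rist v))

/-- If `x` moves `v`, a nontrivial `y ∈ P` supported below `v` equals its conjugate by `x`, which is
supported below `x v`; the two subtrees are disjoint. -/
theorem eq_one_of_commute (hb : IsWeaklyBranch G) {P : Subgroup (TreeAut d)}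
    (hP : P.relIndex G ≠ 0) {x : TreeAut d} (hx : ∀ y ∈ P, x * y = y * x) : x = 1 := by
  by_contra hx1
  obtain ⟨v, hv⟩ := exists_apply_ne hx1
  obtain ⟨y, hyv, hyP, hy1⟩ := rist_ne_bot_of_relIndex_ne_zero hb hP v
  obtain ⟨u, hu⟩ := exists_apply_ne hy1
  have h1 : x * y * x⁻¹ ∈ rist (⊤ : Subgroup (TreeAut d)) (x v) :=
    conj_mem_rist trivial (rist_mono le_top v hyv)
  rw [hx y hyP, mul_inv_cancel_right] at h1
  by_cases huv : v <+: u
  · exact hu ((mem_rist.1 h1).2 u fun h =>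
      hv (eq_of_prefix_of_prefix h huv (x.length_eq v)))
  · exact hu ((mem_rist.1 hyv).2 u huv)

theorem exists_not_commute (hb : IsWeaklyBranch G) {P : Subgroup (TreeAut d)}
    (hP : P.relIndex G ≠ 0) : ∃ x ∈ P, ∃ y ∈ P, x * y ≠ y * x := by
  by_contra h
  push Not at h
  obtain ⟨y, -, hyP, hy1⟩ := rist_ne_bot_of_relIndex_ne_zero hb hP []
  exact hy1 (eq_one_of_commute hb hP fun z hz => h y hyP z hz)

theorem sectionSubgroup_commutator_rist_relIndex_ne_zero (hrep : IsSelfReplicating G)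
    (hb : IsBranch G)
    (hab : ∀ R ≤ G, R.relIndex G ≠ 0 → ⁅R, R⁆.relIndex G ≠ 0)
    {L : Subgroup (TreeAut d)} (hLG : L ≤ G) (hL : L.relIndex G ≠ 0) (v : List (Fin d)) :
    (sectionSubgroup ⁅rist L v, rist L v⁆ v).relIndex G ≠ 0 := by
  have h1 := hab (sectionSubgroup (rist L v) v)
    ((sectionSubgroup_mono ((rist_le L v).trans hLG) v).trans (hrep.1 v))
    (sectionSubgroup_rist_relIndex_ne_zero hrep hb hL v)
  refine relIndex_ne_zero_of_le ?_ h1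
  rw [Subgroup.commutator_le]
  intro a ha b hb
  obtain ⟨x, hx, rfl⟩ := ha
  obtain ⟨y, hy, rfl⟩ := hb
  rw [← map_commutatorElement]
  refine ⟨_, ?_, rfl⟩
  exact (Subgroup.commutator_mem_commutator (H₁ := rist L v) (H₂ := rist L v) hx hy :)

/-- The centre of `N` is again normalized by `L`. If nontrivial it moves some `v`, so it contains
the derived subgroup of `rist L v`, whose section at `v` has finite index in `G` and is therefore
not abelian. -/
theorem eq_one_of_mem_center (hrep : IsSelfReplicating G) (hb : IsBranch G)
    (hab : ∀ R ≤ G, R.relIndex G ≠ 0 → ⁅R, R⁆.relIndex G ≠ 0)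
    {L N : Subgroup (TreeAut d)} (hLG : L ≤ G) (hL : L.relIndex G ≠ 0) (hNL : N ≤ L)
    (hN : ∀ l ∈ L, ∀ x ∈ N, l * x * l⁻¹ ∈ N) {x : TreeAut d} (hx : x ∈ N)
    (hxN : ∀ y ∈ N, x * y = y * x) : x = 1 := by
  by_contra hx1
  obtain ⟨v, hv⟩ := exists_apply_ne hx1
  have hZ : ∀ l ∈ L, ∀ z ∈ N ⊓ Subgroup.centralizer (N : Set (TreeAut d)),
      l * z * l⁻¹ ∈ N ⊓ Subgroup.centralizer (N : Set (TreeAut d)) := by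
    rintro l hl z ⟨hzN, hz⟩
    refine ⟨hN l hl z hzN, Subgroup.mem_centralizer_iff.2 fun y hy => ?_⟩
    have h1 := Subgroup.mem_centralizer_iff.1 hz (l⁻¹ * y * l⁻¹⁻¹) (hN _ (L.inv_mem hl) y hy)
    have h2 := congrArg (fun t => l * t * l⁻¹) h1
    simp only [mul_assoc, inv_inv, mul_inv_cancel_left, mul_inv_cancel, mul_one] at h2
    simpa only [mul_assoc] using h2
  have hxZ : x ∈ N ⊓ Subgroup.centralizer (N : Set (TreeAut d)) :=
    ⟨hx, Subgroup.mem_centralizer_iff.2 fun y hy => (hxN y hy).symm⟩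
  have hle := commutator_rist_le (inf_le_left.trans hNL) hZ hxZ hv
  obtain ⟨a, ha, b, hb', hne⟩ := exists_not_commute hb.toIsWeaklyBranch
    (sectionSubgroup_commutator_rist_relIndex_ne_zero hrep hb hab hLG hL v)
  obtain ⟨⟨a, hav⟩, ha, rfl⟩ := ha
  obtain ⟨⟨b, hbv⟩, hb', rfl⟩ := hb'
  apply hne
  rw [← map_mul, ← map_mul]
  congr 1
  exact Subtype.ext (Subgroup.mem_centralizer_iff.1 (hle hb').2 a (hle ha).1)

/-- A finite index subgroup `L` of a group acting transitively on the levels has, from some level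
`n` on, no more orbits on the levels than on level `n`. -/
theorem exists_orbit_stabilization (hd : 0 < d)
    (htr : ∀ n : ℕ, ∀ v ∈ level d n, ∀ w ∈ level d n, ∃ g ∈ G, g • v = w)
    {L : Subgroup (TreeAut d)} (hL : L.relIndex G ≠ 0) :
    ∃ n : ℕ, ∀ v w : List (Fin d), n ≤ v.length → v.length = w.length →
      (∃ l ∈ L, l (v.take n) = w.take n) → ∃ l ∈ L, l v = w := by
  let o : ℕ → List (Fin d) := fun m => List.replicate m ⟨0, hd⟩
  have ho : ∀ {m n : ℕ}, n ≤ m → (o m).take n = o n := fun h => by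
    simp [o, List.take_replicate, h]
  have hol : ∀ m, (o m).length = m := fun m => by simp [o]
  let Q := G ⧸ L.subgroupOf G
  have : Finite Q := Subgroup.index_ne_zero_iff_finite.1 hL
  -- Inverting representatives of the left cosets represents the right cosets of `L`, so every
  -- vertex of level `m` is `L`-equivalent to some `r q (o m)`. The relation `E m` records which of
  -- these share an orbit; it decreases with `m` inside a finite set, hence stabilizes.
  let r : Q → TreeAut d := fun q => ((q.out : G) : TreeAut d)⁻¹
  let E : ℕ → Set (Q × Q) := fun m => {p | ∃ l ∈ L, l (r p.1 (o m)) = r p.2 (o m)}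
  have hE : ∀ {m n : ℕ}, n ≤ m → E m ⊆ E n := by
    rintro m n hmn ⟨q, q'⟩ ⟨l, hl, h⟩
    refine ⟨l, hl, ?_⟩
    have h1 := congrArg (List.take n) h
    rwa [← TreeAut.take_apply, ← TreeAut.take_apply, ← TreeAut.take_apply, ho hmn] at h1
  obtain ⟨n, hn⟩ := WellFoundedGT.monotone_chain_condition
    (⟨fun m => OrderDual.toDual (E m), fun a b hab => hE hab⟩ : ℕ →o (Set (Q × Q))ᵒᵈ)
  have hn' : ∀ m, n ≤ m → E n = E m := fun m hm => hn m hm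
  have key : ∀ v : List (Fin d), ∃ q : Q, ∃ l ∈ L, l v = r q (o v.length) := by
    intro v
    obtain ⟨g, hg, hgv⟩ := htr v.length (o v.length) (hol _) v rfl
    let q : Q := QuotientGroup.mk (⟨g, hg⟩⁻¹ : G)
    have h1 : (q.out)⁻¹ * (⟨g, hg⟩⁻¹ : G) ∈ L.subgroupOf G :=
      QuotientGroup.leftRel_apply.1 (Quotient.exact (Quotient.out_eq q))
    refine ⟨q, r q * g⁻¹, h1, ?_⟩
    rw [TreeAut.mul_apply, TreeAut.inv_apply_eq hgv]
  refine ⟨n, ?_⟩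
  rintro v w hv hvw ⟨l, hl, hlvw⟩
  obtain ⟨q, a, ha, hav⟩ := key v
  obtain ⟨q', b, hb, hbw⟩ := key w
  have hq : (q, q') ∈ E n := by
    refine ⟨b * l * a⁻¹, L.mul_mem (L.mul_mem hb hl) (L.inv_mem ha), ?_⟩
    change (b * l * a⁻¹) (r q (o n)) = r q' (o n)
    rw [← ho hv, TreeAut.take_apply, ← hav, TreeAut.mul_apply, TreeAut.mul_apply,
      ← TreeAut.take_apply, TreeAut.inv_apply_self, hlvw, TreeAut.take_apply, hbw,
      ← TreeAut.take_apply, hvw]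
  rw [hn' _ hv] at hq
  obtain ⟨c, hc, hcq⟩ := hq
  refine ⟨b⁻¹ * c * a, L.mul_mem (L.mul_mem (L.inv_mem hb) hc) ha, ?_⟩
  change c (r q (o v.length)) = r q' (o v.length) at hcq
  rw [TreeAut.mul_apply, TreeAut.mul_apply, hav, hcq, hvw, ← hbw, TreeAut.inv_apply_self]

/-- At a deep enough level, a subgroup `N` normalised by a subgroup `L` of finite index either
moves a given vertex or acts trivially on the subtree below it. -/
theorem exists_level_moved_or_fixed (hd : 0 < d)
    (htr : ∀ n : ℕ, ∀ v ∈ level d n, ∀ w ∈ level d n, ∃ g ∈ G, g • v = w)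
    {L N : Subgroup (TreeAut d)} (hL : L.relIndex G ≠ 0)
    (hN : ∀ l ∈ L, ∀ x ∈ N, l * x * l⁻¹ ∈ N) :
    ∃ n : ℕ, ∀ v : List (Fin d), v.length = n →
      (∃ x ∈ N, x v ≠ v) ∨ ∀ x ∈ N, ∀ w, v <+: w → x w = w := by
  obtain ⟨n₀, hn₀⟩ := exists_orbit_stabilization hd htr hL
  have h1 : ∀ v : level d n₀, ∃ m : ℕ, (∃ x ∈ N, ∃ w, v.1 <+: w ∧ w.length = m ∧ x w ≠ w) ∨
      ∀ x ∈ N, ∀ w, v.1 <+: w → x w = w := by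
    intro v
    by_cases h : ∀ x ∈ N, ∀ w, v.1 <+: w → x w = w
    · exact ⟨0, Or.inr h⟩
    · push Not at h
      obtain ⟨x, hx, w, hvw, hxw⟩ := h
      exact ⟨w.length, Or.inl ⟨x, hx, w, hvw, rfl, hxw⟩⟩
  choose m hm using h1
  -- At level `max n₀ M` each vertex below a nontrivially acted-on subtree has a prefix at the level
  -- of the moved vertex `w`. That prefix is `L`-equivalent to `w`, so a conjugate of `x` moves it,
  -- and with it the vertex.
  obtain ⟨M, hM⟩ := (Set.finite_range m).bddAbove
  refine ⟨max n₀ M, fun u hu => ?_⟩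
  have hun : (u.take n₀).length = n₀ := by simp [hu]
  rcases hm ⟨u.take n₀, hun⟩ with ⟨x, hx, w, hvw, hwm, hxw⟩ | h
  · left
    have hwu : w.length ≤ u.length := by
      rw [hwm, hu]
      exact (hM ⟨_, rfl⟩).trans (le_max_right _ _)
    have hwn : n₀ ≤ w.length := by
      have := hvw.length_le
      rwa [hun] at this
    have hl' : w.length = (u.take w.length).length := by simp [hwu]
    obtain ⟨l, hl, hlw⟩ := hn₀ w (u.take w.length) hwn hl' ⟨1, L.one_mem, by
      change w.take n₀ = _
      rw [List.take_take, min_eq_left hwn]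
      exact eq_of_prefix_of_prefix (List.take_prefix _ _) hvw (by simp [hwn, hun])⟩
    refine ⟨l * x * l⁻¹, hN l hl x hx, fun hfix => hxw ?_⟩
    have h2 := congrArg (List.take w.length) hfix
    rw [← TreeAut.take_apply, ← hlw, TreeAut.mul_apply, TreeAut.mul_apply,
      TreeAut.inv_apply_self] at h2
    exact l.injective h2
  · exact Or.inr fun x hx w huw => h x hx w ((List.take_prefix _ _).trans huw)

end Branch

/-! ### Products of subgroups of rigid stabilizers; virtual complements in branch groups. -/

section Product

variable {d : ℕ}

/-- The elements of the stabilizer of level `n` whose sections at the vertices `v` of level `n`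
lie in the sections of `K v`. -/
def sectionProduct {n : ℕ} (K : level d n → Subgroup (TreeAut d)) : Subgroup (TreeAut d) :=
  ((Subgroup.pi Set.univ fun v : level d n => sectionSubgroup (K v) v.1).comap
    (levelSections d n)).map (stabLevel ⊤ n).subtype

/-- A finite product is generated by its factors and `levelSections` is injective, so
`sectionProduct K` is the internal product of the `K v`. -/
theorem sectionProduct_le_of_forall_le {n : ℕ} {G M : Subgroup (TreeAut d)}
    {K : level d n → Subgroup (TreeAut d)} (hK : ∀ v, K v ≤ rist G v.1) (hM : ∀ v, K v ≤ M) :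
    sectionProduct K ≤ M := by
  classical
  have h : Subgroup.pi Set.univ (fun v : level d n => sectionSubgroup (K v) v.1) ≤
      (M.subgroupOf (stabLevel ⊤ n)).map (levelSections d n) := by
    refine Subgroup.pi_le_iff.2 fun v => ?_
    rintro _ ⟨_, hx, rfl⟩
    obtain ⟨g, ⟨hg, -⟩, rfl⟩ := mem_sectionSubgroup.1 hx
    have hg' : g ∈ stabLevel (⊤ : Subgroup (TreeAut d)) n := by
      have h1 := rist_le_stabLevel ⊤ v.1 (rist_mono le_top v.1 (hK v hg))
      have h2 : v.1.length = n := v.2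
      rwa [h2] at h1
    exact ⟨⟨g, hg'⟩, hM v hg, levelSections_rist (hK v hg) hg'⟩
  rintro _ ⟨g, hg, rfl⟩
  obtain ⟨g', hg', hgg'⟩ := h hg
  rwa [levelSections_injective n hgg'] at hg'

theorem mem_sectionProduct {n : ℕ} {K : level d n → Subgroup (TreeAut d)} {g : TreeAut d} :
    g ∈ sectionProduct K ↔ (∀ v : List (Fin d), v.length = n → g v = v) ∧
      ∀ v : level d n, g.sectionAt v.1 ∈ sectionSubgroup (K v) v.1 := by
  constructor
  · rintro ⟨g, hg, rfl⟩
    exact ⟨(mem_stabLevel.1 g.2).2, fun v => hg v trivial⟩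
  · rintro ⟨h1, h2⟩
    exact ⟨⟨g, mem_stabLevel.2 ⟨trivial, h1⟩⟩, fun v _ => h2 v, rfl⟩

theorem mem_sectionProduct_of_mem {n : ℕ} {G : Subgroup (TreeAut d)}
    {K : level d n → Subgroup (TreeAut d)} {v : level d n} (hK : K v ≤ rist G v.1)
    {g : TreeAut d} (hg : g ∈ K v) : g ∈ sectionProduct K := by
  have hv : v.1.length = n := v.2
  refine mem_sectionProduct.2
    ⟨fun w hw => rist_apply_of_length (hK hg) (hw.trans hv.symm), fun w => ?_⟩
  rcases eq_or_ne w v with rfl | hwv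
  · exact sectionAt_mem_sectionSubgroup hg (rist_apply_self (hK hg))
  · rw [(sectionAt_eq_one_iff (rist_apply_of_length (hK hg) (w.2.trans hv.symm))).2]
    · exact one_mem _
    · exact fun u hu => (mem_rist.1 (hK hg)).2 u fun h =>
        hwv (Subtype.ext (eq_of_prefix_of_prefix hu h (w.2.trans hv.symm)))

theorem pi_relIndex_ne_zero {A ι : Type*} [Group A] [Finite ι] {H : ι → Subgroup A}
    {G : Subgroup A} (h : ∀ i, (H i).relIndex G ≠ 0) :
    (Subgroup.pi Set.univ H).relIndex (Subgroup.pi Set.univ fun _ => G) ≠ 0 := by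
  have h1 : Subgroup.pi Set.univ H = ⨅ i, (H i).comap (Pi.evalMonoidHom (fun _ => A) i) := by
    ext x
    simp [Subgroup.mem_pi, Subgroup.mem_iInf]
  rw [h1]
  refine Subgroup.relIndex_iInf_ne_zero fun i => ?_
  rw [Subgroup.relIndex_comap]
  refine relIndex_ne_zero_of_le_right ?_ (h i)
  rintro _ ⟨w, hw, rfl⟩
  exact hw i trivial

theorem sectionProduct_relIndex_ne_zero {n : ℕ} {G : Subgroup (TreeAut d)}
    (hG : IsSelfSimilar G) {K : level d n → Subgroup (TreeAut d)}
    (hK : ∀ v, (sectionSubgroup (K v) v.1).relIndex G ≠ 0) :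
    (sectionProduct K).relIndex G ≠ 0 := by
  refine Subgroup.relIndex_ne_zero_trans ?_ (stabLevel_relIndex_ne_zero G n)
  have h := relIndex_map_ne_zero (stabLevel (⊤ : Subgroup (TreeAut d)) n).subtype
    (Subgroup.relIndex_comap_ne_zero (levelSections d n) (pi_relIndex_ne_zero hK))
  refine relIndex_ne_zero_of_le_right ?_ h
  intro g hg
  rw [mem_stabLevel] at hg
  refine ⟨⟨g, mem_stabLevel.2 ⟨trivial, hg.2⟩⟩, fun v _ => ?_, rfl⟩
  exact hG v.1 (sectionAt_mem_sectionSubgroup hg.1 (hg.2 v v.2))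

/-- A subgroup that contains the factors `K v` for `v ∈ V` and acts trivially below the other
vertices of the level is commensurable with a direct power of `G`. -/
theorem groupCommensurable_pow_of_level {G N : Subgroup (TreeAut d)} (hG : IsSelfSimilar G)
    (hNG : N ≤ G) {n : ℕ} {K : level d n → Subgroup (TreeAut d)} (hKr : ∀ v, K v ≤ rist G v.1)
    (hK : ∀ v, (sectionSubgroup (K v) v.1).relIndex G ≠ 0) (V : Set (level d n))
    (hV : ∀ v ∈ V, K v ≤ N) (hV' : ∀ v ∉ V, ∀ x ∈ N, ∀ w, v.1 <+: w → x w = w) :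
    GroupCommensurable N (V → G) := by
  classical
  -- On `C` the sections at `V` are faithful, the others being trivial, and their image contains the
  -- product of the sections of the `K v`.
  let C : Subgroup N := (sectionProduct K).subgroupOf N
  have hC : C.index ≠ 0 := relIndex_ne_zero_of_le_right hNG (sectionProduct_relIndex_ne_zero hG hK)
  have hCmem : ∀ c : C, (c : TreeAut d) ∈ stabLevel (⊤ : Subgroup (TreeAut d)) n := fun c =>
    mem_stabLevel.2 ⟨trivial, (mem_sectionProduct.1 c.2).1⟩
  let ι : C →* stabLevel (⊤ : Subgroup (TreeAut d)) n :=
    (N.subtype.comp C.subtype).codRestrict _ hCmem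
  let f : C →* (V → G) := MonoidHom.pi fun v : V =>
    ((Pi.evalMonoidHom (fun _ => TreeAut d) v.1).comp ((levelSections d n).comp ι)).codRestrict G
      fun c => hG v.1.1 (sectionAt_mem_sectionSubgroup (hNG c.1.2)
        ((mem_stabLevel.1 (hCmem c)).2 _ v.1.2))
  have hf : ∀ (c : C) (v : V), (f c v : TreeAut d) = (c : TreeAut d).sectionAt v.1.1 :=
    fun _ _ => rfl
  refine (groupCommensurable_of_index_ne_zero hC).symm.trans
    (IsVirtualIso.groupCommensurable (f := f) ⟨?_, ?_⟩)
  · refine (injective_iff_map_eq_one _).2 fun c hc => Subtype.ext (Subtype.ext ?_)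
    refine eq_one_of_sectionAt_eq_one (mem_stabLevel.1 (hCmem c)).2 fun v hv => ?_
    by_cases hvV : (⟨v, hv⟩ : level d n) ∈ V
    · rw [← hf c ⟨⟨v, hv⟩, hvV⟩, hc]
      rfl
    · exact (sectionAt_eq_one_iff ((mem_stabLevel.1 (hCmem c)).2 v hv)).2
        (hV' _ hvV _ c.1.2)
  · refine index_ne_zero_of_le (H := Subgroup.pi Set.univ fun v : V =>
      (sectionSubgroup (K v.1) v.1.1).subgroupOf G) ?_ (index_pi_ne_zero fun v => hK v.1)
    refine Subgroup.pi_le_iff.2 fun v => ?_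
    rintro _ ⟨⟨y, hyG⟩, hy, rfl⟩
    obtain ⟨g, ⟨hg, -⟩, rfl⟩ := mem_sectionSubgroup.1 hy
    refine ⟨⟨⟨g, hV v v.2 hg⟩, mem_sectionProduct_of_mem (hKr v) hg⟩, ?_⟩
    ext1 w
    apply Subtype.ext
    rw [hf]
    rcases eq_or_ne w v with rfl | hwv
    · rw [MonoidHom.mulSingle_apply, Pi.mulSingle_eq_same]
    · rw [MonoidHom.mulSingle_apply, Pi.mulSingle_eq_of_ne hwv]
      have hl : w.1.1.length = v.1.1.length := w.1.2.trans v.1.2.symm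
      refine (sectionAt_eq_one_iff (rist_apply_of_length (hKr v hg) hl)).2 fun u hu => ?_
      exact (mem_rist.1 (hKr v hg)).2 u fun h =>
        hwv (Subtype.ext (Subtype.ext (eq_of_prefix_of_prefix hu h hl)))

variable {G : Subgroup (TreeAut d)}

theorem commute_of_fixed_below {N : Subgroup (TreeAut d)} {v : List (Fin d)}
    (h : ∀ x ∈ N, ∀ w, v <+: w → x w = w) {x y : TreeAut d} (hx : x ∈ N) (hy : y ∈ rist G v) :
    x * y = y * x := by
  apply RelIso.ext
  intro u
  change x (y u) = y (x u)
  by_cases hu : v <+: u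
  · rw [h x hx u hu, h x hx _ ((rist_prefix_apply hy).2 hu)]
  · rw [(mem_rist.1 hy).2 u hu, (mem_rist.1 hy).2]
    intro hv
    exact hu (x.injective (h x hx _ hv) ▸ hv)

/-- The derived subgroups of finite index subgroups of `G` have finite index. -/
def HasFiniteAbelianizations (G : Subgroup (TreeAut d)) : Prop :=
  ∀ R ≤ G, R.relIndex G ≠ 0 → ⁅R, R⁆.relIndex G ≠ 0

/-- At a deep level `N` contains `[Rist_L(v), Rist_L(v)]` for the vertices it moves and is
centralized by it for the others. Together these derived subgroups generate a finite index subgroup.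
`D` stands for any subgroup containing the centralizer of `N` in `G`. -/
theorem virtualComplement (hd : 0 < d) (hrep : IsSelfReplicating G) (hb : IsBranch G)
    (hab : HasFiniteAbelianizations G) {L N : Subgroup (TreeAut d)} (hLG : L ≤ G)
    (hL : L.relIndex G ≠ 0) (hNL : N ≤ L) (hN : ∀ l ∈ L, ∀ x ∈ N, l * x * l⁻¹ ∈ N) :
    (∀ D : Subgroup (TreeAut d), (∀ y ∈ G, (∀ x ∈ N, x * y = y * x) → y ∈ D) →
      (N ⊔ D).relIndex G ≠ 0) ∧
    (∃ V : Type, Finite V ∧ GroupCommensurable N (V → G)) := by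
  obtain ⟨n, hn⟩ := exists_level_moved_or_fixed hd hb.transitive hL hN
  let K : level d n → Subgroup (TreeAut d) := fun v => ⁅rist L v.1, rist L v.1⁆
  have hKL : ∀ v, K v ≤ rist L v.1 := fun v => Subgroup.commutator_le_self _
  have hKr : ∀ v, K v ≤ rist G v.1 := fun v => (hKL v).trans (rist_mono hLG v.1)
  have hK : ∀ v, (sectionSubgroup (K v) v.1).relIndex G ≠ 0 := fun v =>
    sectionSubgroup_commutator_rist_relIndex_ne_zero hrep hb hab hLG hL v.1
  let V : Set (level d n) := {v | ∃ x ∈ N, x v.1 ≠ v.1}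
  have hV : ∀ v ∈ V, K v ≤ N := by
    rintro v ⟨x, hx, hxv⟩
    exact commutator_rist_le hNL hN hx hxv
  have hV' : ∀ v ∉ V, ∀ x ∈ N, ∀ w, v.1 <+: w → x w = w := fun v hv =>
    (hn v.1 v.2).resolve_left hv
  refine ⟨fun D hD => ?_, V, inferInstance,
    groupCommensurable_pow_of_level hrep.1 (hNL.trans hLG) hKr hK V hV hV'⟩
  refine relIndex_ne_zero_of_le (sectionProduct_le_of_forall_le hKr fun v => ?_)
    (sectionProduct_relIndex_ne_zero hrep.1 hK)
  by_cases hv : v ∈ V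
  · exact (hV v hv).trans le_sup_left
  · refine le_trans (fun y hy => ?_) le_sup_right
    exact hD y (rist_le G _ (hKr v hy)) fun x hx => commute_of_fixed_below (hV' v hv) hx (hKr v hy)

theorem relIndex_map_subtype {A : Type*} [Group A] {G : Subgroup A} (L : Subgroup G) :
    (L.map G.subtype).relIndex G = L.index := by
  rw [Subgroup.relIndex, Subgroup.subgroupOf,
    Subgroup.comap_map_eq_self_of_injective G.subtype_injective]

theorem hasVirtualComplements (hd : 0 < d) (hrep : IsSelfReplicating G) (hb : IsBranch G)
    (hab : HasFiniteAbelianizations G) : HasVirtualComplements G := by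
  have hmap : ∀ {L N : Subgroup G}, (∀ l ∈ L, ∀ x ∈ N, l * x * l⁻¹ ∈ N) →
      ∀ l ∈ L.map G.subtype, ∀ x ∈ N.map G.subtype, l * x * l⁻¹ ∈ N.map G.subtype := by
    rintro L N h _ ⟨l, hl, rfl⟩ _ ⟨x, hx, rfl⟩
    exact ⟨_, h l hl x hx, rfl⟩
  have hidx : ∀ {L : Subgroup G}, L.index ≠ 0 → (L.map G.subtype).relIndex G ≠ 0 := fun h => by
    rwa [relIndex_map_subtype]
  refine ⟨?_, ?_, ?_, ?_⟩
  · intro L hL N hNL hN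
    rw [eq_bot_iff]
    rintro x ⟨hx, hxC⟩
    refine Subgroup.mem_bot.2 (Subtype.ext (eq_one_of_mem_center hrep hb hab
      (Subgroup.map_subtype_le L) (hidx hL) (Subgroup.map_mono hNL) (hmap hN) ⟨x, hx, rfl⟩ ?_))
    rintro _ ⟨y, hy, rfl⟩
    exact congrArg Subtype.val (Subgroup.mem_centralizer_iff.1 hxC y hy).symm
  · intro L hL N hNL hN
    have h := (virtualComplement hd hrep hb hab (Subgroup.map_subtype_le L) (hidx hL)
      (Subgroup.map_mono hNL) (hmap hN)).1
      ((Subgroup.centralizer (N : Set G)).map G.subtype) ?_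
    · rwa [← Subgroup.map_sup, relIndex_map_subtype] at h
    · intro y hy hcomm
      refine ⟨⟨y, hy⟩, Subgroup.mem_centralizer_iff.2 fun x hx => Subtype.ext ?_, rfl⟩
      exact hcomm x ⟨x, hx, rfl⟩
  · intro L hL N hNL hN
    obtain ⟨V, _, hV⟩ := (virtualComplement hd hrep hb hab (Subgroup.map_subtype_le L) (hidx hL)
      (Subgroup.map_mono hNL) (hmap hN)).2
    obtain ⟨k, ⟨e⟩⟩ := Finite.exists_equiv_fin V
    exact ⟨k, (GroupCommensurable.of_mulEquiv
      (N.equivMapOfInjective G.subtype G.subtype_injective)).trans (hV.pow_reindex e)⟩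
  · intro P hP
    rw [eq_bot_iff]
    intro x hx
    refine Subgroup.mem_bot.2 (Subtype.ext (eq_one_of_commute hb.toIsWeaklyBranch (hidx hP) ?_))
    rintro _ ⟨y, hy, rfl⟩
    exact congrArg Subtype.val (Subgroup.mem_centralizer_iff.1 hx y hy).symm

/-- A branch group is commensurable with its `d`-th power. -/
theorem groupCommensurable_pow_degree (hrep : IsSelfReplicating G) (hb : IsBranch G) :
    GroupCommensurable G (Fin d → G) := by
  have h := groupCommensurable_pow_of_level (N := G) (n := 1) hrep.1 le_rfl
    (K := fun v => rist G v.1) (fun _ => le_rfl)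
    (fun v => sectionSubgroup_rist_relIndex_ne_zero hrep hb (by simp) v.1) Set.univ
    (fun v _ => rist_le G v.1) (fun v hv => absurd trivial hv)
  refine h.pow_reindex ((Equiv.Set.univ _).trans (Finite.equivFinOfCardEq card_level_one))

instance (G : Subgroup (TreeAut d)) : Group.ResiduallyFinite G := by
  have h : Group.ResiduallyFinite (TreeAut d) := by
    rw [Group.residuallyFinite_iff_forall_finiteIndex]
    intro g hg
    by_contra hne
    obtain ⟨v, hv⟩ := exists_apply_ne hne
    exact hv (@hg (MulAction.stabilizer (TreeAut d) v) ⟨index_stabilizer_ne_zero v⟩)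
  infer_instance

end Product

/-! ### Tame subgroups and their recovery from coordinates. -/

section Tame

variable {Γ : Type} [Group Γ]

/-- Subgroups that are commensurable with a direct power of `Γ` and all of whose finite index
subgroups are closed in the profinite topology. -/
def IsTame (Γ : Type) [Group Γ] {B : Type} [Group B] (H : Subgroup B) : Prop :=
  IsStronglySeparable H ∧ IsCommensurableToPower Γ H

variable {A B : Type} [Group A] [Group B]

theorem groupCommensurable_of_relIndex_ne_zero {H K : Subgroup B} (hle : H ≤ K)
    (h : H.relIndex K ≠ 0) : GroupCommensurable H K :=
  (GroupCommensurable.of_mulEquiv (Subgroup.subgroupOfEquivOfLe hle).symm).trans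
    (groupCommensurable_of_index_ne_zero (H := H.subgroupOf K) h)

theorem IsTame.iff_of_relIndex_ne_zero {H K : Subgroup B} (hle : H ≤ K) (h : H.relIndex K ≠ 0) :
    IsTame Γ K ↔ IsTame Γ H :=
  ⟨fun hK => ⟨hK.1.of_relIndex_ne_zero hle h,
    hK.2.of_groupCommensurable (groupCommensurable_of_relIndex_ne_zero hle h)⟩,
  fun hH => ⟨hH.1.of_finiteIndex_subgroup hle h,
    hH.2.of_groupCommensurable (groupCommensurable_of_relIndex_ne_zero hle h).symm⟩⟩

theorem IsTame.of_map {f : A →* B} (hf : Function.Injective f) {H : Subgroup A}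
    (h : IsTame Γ (H.map f)) : IsTame Γ H := by
  refine ⟨fun U hU hUH => ?_, h.2.of_groupCommensurable
    (.of_mulEquiv (H.equivMapOfInjective f hf))⟩
  have h1 := (h.1 (U.map f) (Subgroup.map_mono hU) (relIndex_map_ne_zero f hUH)).comap f
  rwa [Subgroup.comap_map_eq_self_of_injective hf] at h1

theorem IsTame.map_subtype {S : Subgroup B} (hS : S.index ≠ 0) {H : Subgroup S}
    (h : IsTame Γ H) : IsTame Γ (H.map S.subtype) := by
  refine ⟨fun U hU hUH => ?_, h.2.of_groupCommensurable
    (GroupCommensurable.of_mulEquiv (H.equivMapOfInjective _ S.subtype_injective)).symm⟩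
  have hUS : U ≤ S := hU.trans (Subgroup.map_subtype_le H)
  have h1 : U.subgroupOf S ≤ H := by
    intro x hx
    obtain ⟨y, hy, hxy⟩ := hU hx
    rwa [← S.subtype_injective hxy]
  have h2 : (U.subgroupOf S).relIndex H ≠ 0 := by
    have := Subgroup.relIndex_comap_ne_zero S.subtype hUH
    rwa [Subgroup.comap_map_eq_self_of_injective S.subtype_injective] at this
  have h3 := (IsStronglySeparable.of_index_ne_zero hS).map_subtype (h.1 _ h1 h2)
  rwa [Subgroup.subgroupOf_map_subtype, inf_eq_left.2 hUS] at h3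

theorem IsCommensurableToPower.exists_isVirtualIso {K : Subgroup B}
    (h : IsCommensurableToPower Γ K) :
    ∃ C ≤ K, C.relIndex K ≠ 0 ∧ ∃ (k : ℕ) (f : C →* (Fin k → Γ)), IsVirtualIso f := by
  obtain ⟨k, A₁, B₁, hA, hB, ⟨e⟩⟩ := h
  refine ⟨A₁.map K.subtype, Subgroup.map_subtype_le A₁, ?_, k,
    (B₁.subtype.comp e.toMonoidHom).comp
      (A₁.equivMapOfInjective _ K.subtype_injective).symm.toMonoidHom, ?_⟩
  · rw [relIndex_map_subtype]
    exact hA.index_ne_zero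
  · exact ((IsVirtualIso.subtype hB.index_ne_zero).comp (IsVirtualIso.of_mulEquiv e)).comp
      (IsVirtualIso.of_mulEquiv _)

/-- Each projection contains a finite index `C v` that is virtually `Γ ^ (k v)`. Refining every
coordinate this way embeds `W = ∏ C v` into a larger power by `Φ`, where finite index subgroups of
`K ⊓ W` have finite index projections. Closedness returns along `Φ` to `W`, and from `W` to the
whole power because `W` is strongly separable. -/
theorem IsTame.of_forall_coordinate (hΓ : HasVirtualComplements Γ) [Group.ResiduallyFinite Γ]
    {κ : Type} [Finite κ] {K : Subgroup (κ → Γ)}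
    (hK : ∀ v, IsTame Γ (K.map (Pi.evalMonoidHom (fun _ => Γ) v))) : IsTame Γ K := by
  choose C hCK hC k f hf using fun v => (hK v).2.exists_isVirtualIso
  let W : Subgroup (κ → Γ) := Subgroup.pi Set.univ C
  have hW : IsStronglySeparable W :=
    IsStronglySeparable.pi fun v => (hK v).1.of_relIndex_ne_zero (hCK v) (hC v)
  let p : ∀ v, W →* C v := fun v =>
    ((Pi.evalMonoidHom (fun _ => Γ) v).comp W.subtype).codRestrict (C v) fun w => w.2 v trivial
  let Φ : W →* ((Σ v, Fin (k v)) → Γ) :=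
    MonoidHom.pi fun s => (Pi.evalMonoidHom (fun _ => Γ) s.2).comp ((f s.1).comp (p s.1))
  have hΦ : Function.Injective Φ := by
    intro w w' hww'
    refine Subtype.ext (funext fun v => ?_)
    have h1 : f v (p v w) = f v (p v w') := funext fun i => congrFun hww' ⟨v, i⟩
    exact congrArg Subtype.val ((hf v).1 h1)
  have hfull : ∀ U ≤ K ⊓ W, U.relIndex K ≠ 0 →
      HasVirtuallyFullCoordinates ((U.subgroupOf W).map Φ) := by
    rintro U hU hUK ⟨v, i⟩
    rw [Subgroup.map_map]
    have h1 : ((U.subgroupOf W).map (p v)).index ≠ 0 := by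
      refine index_ne_zero_of_le
        (H := (U.map (Pi.evalMonoidHom (fun _ => Γ) v)).subgroupOf (C v)) ?_
        (relIndex_ne_zero_of_le_right (hCK v) (relIndex_map_ne_zero _ hUK))
      rintro x ⟨u, hu, hux⟩
      exact ⟨⟨u, (hU hu).2⟩, hu, Subtype.ext hux⟩
    have h2 : ((Pi.evalMonoidHom (fun _ => Γ) i).comp (f v)).range.index ≠ 0 := by
      rw [MonoidHom.range_comp]
      refine index_map_ne_zero ?_ (hf v).2
      rw [MonoidHom.range_eq_top.2 (Function.surjective_eval i), Subgroup.index_top]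
      exact one_ne_zero
    have h3 := index_map_ne_zero h2 h1
    rwa [Subgroup.map_map] at h3
  have hKW : (K ⊓ W).relIndex K ≠ 0 := by
    have h : (⨅ v, (C v).comap (Pi.evalMonoidHom (fun _ => Γ) v)) ≤ W := by
      intro x hx v _
      exact Subgroup.mem_iInf.1 hx v
    rw [Subgroup.inf_relIndex_left]
    refine relIndex_ne_zero_of_le h (Subgroup.relIndex_iInf_ne_zero fun v => ?_)
    rw [Subgroup.relIndex_comap]
    exact hC v
  refine (IsTame.iff_of_relIndex_ne_zero inf_le_left hKW).2 ⟨fun U hU hUKW => ?_, ?_⟩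
  · have h1 := (hΓ.isSeparable_of_virtuallyFullCoordinates
      (hfull U hU (Subgroup.relIndex_ne_zero_trans hUKW hKW))).comap Φ
    rw [Subgroup.comap_map_eq_self_of_injective hΦ] at h1
    have h2 := hW.map_subtype h1
    rwa [Subgroup.subgroupOf_map_subtype, inf_eq_left.2 (hU.trans inf_le_right)] at h2
  · refine (hΓ.isCommensurableToPower (hfull _ le_rfl hKW)).of_groupCommensurable ?_
    exact GroupCommensurable.of_mulEquiv
      ((Subgroup.subgroupOfEquivOfLe inf_le_right).symm.trans
        (((K ⊓ W).subgroupOf W).equivMapOfInjective Φ hΦ))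

theorem IsTame.of_sections (hΓ : HasVirtualComplements Γ) [Group.ResiduallyFinite Γ]
    {κ : Type} [Finite κ] {S : Subgroup Γ} (hS : S.index ≠ 0) {σ : S →* (κ → Γ)}
    (hσ : Function.Injective σ) {H : Subgroup Γ} (hHS : H ≤ S)
    (hH : ∀ v, IsTame Γ (((H.subgroupOf S).map σ).map (Pi.evalMonoidHom (fun _ => Γ) v))) :
    IsTame Γ H := by
  have h := (IsTame.of_map hσ (IsTame.of_forall_coordinate hΓ hH)).map_subtype hS
  rwa [Subgroup.subgroupOf_map_subtype, inf_eq_left.2 hHS] at h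

theorem isTame_bot [Group.ResiduallyFinite B] : IsTame Γ (⊥ : Subgroup B) := by
  constructor
  · intro U hU _ x hx
    have hx1 : x ≠ 1 := fun h => hx (h ▸ U.one_mem)
    obtain ⟨N, hN, hxN⟩ := Group.residuallyFinite_iff_exists_finiteIndex.1 ‹_› x hx1
    exact ⟨N, hN.index_ne_zero, hU.trans bot_le, hxN⟩
  · refine ⟨0, .of_mulEquiv ⟨⟨fun _ => 1, fun _ => 1, fun _ => Subsingleton.elim _ _,
      fun _ => Subsingleton.elim _ _⟩, fun _ _ => Subsingleton.elim _ _⟩⟩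

theorem isTame_top : IsTame Γ (⊤ : Subgroup Γ) :=
  ⟨.of_index_ne_zero (by simp), 1, .of_mulEquiv (Subgroup.topEquiv.trans
    (MulEquiv.piUnique fun _ : Fin 1 => Γ).symm)⟩

end Tame

/-! ### Consequences of subgroup induction: finite generation, torsion, tameness. -/

section Induction

theorem fg_of_relIndex_ne_zero {B : Type*} [Group B] {H L : Subgroup B} (hle : H ≤ L)
    (hfi : H.relIndex L ≠ 0) (hH : H.FG) : L.FG := by
  have hfin : Finite (L ⧸ H.subgroupOf L) := Subgroup.index_ne_zero_iff_finite.1 hfi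
  let s : Set B := Set.range fun q : L ⧸ H.subgroupOf L => ((q.out : L) : B)
  have h : L = H ⊔ Subgroup.closure s := by
    refine le_antisymm (fun x hx => ?_) (sup_le hle ((Subgroup.closure_le _).2 ?_))
    · let q : L ⧸ H.subgroupOf L := QuotientGroup.mk ⟨x, hx⟩
      have h1 : (q.out)⁻¹ * (⟨x, hx⟩ : L) ∈ H.subgroupOf L :=
        QuotientGroup.leftRel_apply.1 (Quotient.exact (Quotient.out_eq q))
      have h2 : x = ((q.out : L) : B) * (((q.out : L) : B)⁻¹ * x) := by simp
      rw [h2]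
      exact Subgroup.mul_mem _ (le_sup_right (a := H) (Subgroup.subset_closure ⟨q, rfl⟩))
        (le_sup_left (b := Subgroup.closure s) h1)
    · rintro _ ⟨q, rfl⟩
      exact q.out.2
  rw [h]
  exact hH.sup ((Subgroup.fg_iff _).2 ⟨s, rfl, Set.finite_range _⟩)

theorem fg_of_relIndex_ne_zero_of_le {B : Type*} [Group B] {H L : Subgroup B} (hle : H ≤ L)
    (hfi : H.relIndex L ≠ 0) (hL : L.FG) : H.FG := by
  have h1 : Group.FG L := (Group.fg_iff_subgroup_fg L).2 hL
  have h2 : (H.subgroupOf L).FiniteIndex := ⟨hfi⟩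
  have h3 : Group.FG (H.subgroupOf L) := Subgroup.fg_of_index_ne_zero _
  exact (Group.fg_iff_subgroup_fg H).1
    (Group.fg_of_surjective (f := (Subgroup.subgroupOfEquivOfLe hle).toMonoidHom)
      (Subgroup.subgroupOfEquivOfLe hle).surjective)

theorem finite_iff_of_relIndex_ne_zero {B : Type*} [Group B] {H L : Subgroup B} (hle : H ≤ L)
    (hfi : H.relIndex L ≠ 0) : Finite L ↔ Finite H := by
  rw [Subgroup.finite_iff_finite_and_finiteIndex (H := H.subgroupOf L)]
  exact ⟨fun h => @Finite.of_equiv _ _ h.1 (Subgroup.subgroupOfEquivOfLe hle).toEquiv,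
    fun h => ⟨Finite.of_equiv _ (Subgroup.subgroupOfEquivOfLe hle).symm.toEquiv, ⟨hfi⟩⟩⟩

variable {d : ℕ} {G : Subgroup (TreeAut d)}

theorem sectionAt_mem_of_le_stabLevel {H : Subgroup (TreeAut d)} {n : ℕ}
    (hH : H ≤ stabLevel G n) {g : TreeAut d} (hg : g ∈ H) {v : List (Fin d)}
    (hv : v.length = n) : g.sectionAt v ∈ sectionSubgroup H v :=
  sectionAt_mem_sectionSubgroup hg ((mem_stabLevel.1 (hH hg)).2 v hv)

theorem finite_of_finite_sections {H : Subgroup (TreeAut d)} {n : ℕ}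
    (hH : H ≤ stabLevel G n) (h : ∀ v ∈ level d n, Finite (sectionSubgroup H v)) :
    Finite H := by
  have : ∀ v : level d n, Finite (sectionSubgroup H v.1) := fun v => h v.1 v.2
  refine Finite.of_injective (fun (g : H) (v : level d n) =>
    (⟨_, sectionAt_mem_of_le_stabLevel hH g.2 v.2⟩ : sectionSubgroup H v.1)) ?_
  intro g g' hgg'
  have hS : ∀ g : H, (g : TreeAut d) ∈ stabLevel (⊤ : Subgroup (TreeAut d)) n := fun g =>
    mem_stabLevel.2 ⟨trivial, (mem_stabLevel.1 (hH g.2)).2⟩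
  have h1 : levelSections d n ⟨g, hS g⟩ = levelSections d n ⟨g', hS g'⟩ :=
    funext fun v => congrArg Subtype.val (congrFun hgg' v)
  exact Subtype.ext (congrArg (fun x : stabLevel (⊤ : Subgroup (TreeAut d)) n => (x : TreeAut d))
    (levelSections_injective n h1))

theorem sectionSubgroup_fg {H : Subgroup (TreeAut d)} {n : ℕ} (hH : H ≤ stabLevel G n)
    (hfg : H.FG) {v : List (Fin d)} (hv : v.length = n) : (sectionSubgroup H v).FG := by
  have hle : H ≤ MulAction.stabilizer (TreeAut d) v := fun g hg =>
    (mem_stabLevel.1 (hH hg)).2 v hv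
  have h1 : Group.FG H := (Group.fg_iff_subgroup_fg H).2 hfg
  have h2 : Group.FG (H.subgroupOf (MulAction.stabilizer (TreeAut d) v)) :=
    Group.fg_of_surjective (f := (Subgroup.subgroupOfEquivOfLe hle).symm.toMonoidHom)
      (Subgroup.subgroupOfEquivOfLe hle).symm.surjective
  exact (Group.fg_iff_subgroup_fg _).1
    (Group.fg_of_surjective ((sectionHom v).subgroupMap_surjective _))

/-- A group with the subgroup induction property is finitely generated or locally finite. -/
theorem fg_of_subgroupInduction (hind : HasSubgroupInduction G) {H : Subgroup (TreeAut d)}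
    (hHG : H ≤ G) (hfg : H.FG) (hinf : Infinite H) : G.FG := by
  by_contra hG
  -- If `G` is not finitely generated it belongs to this class. For the section axiom, sections of a
  -- finitely generated `K` are finitely generated, hence finite.
  have hX : IsInductiveClass G {K | K ≤ G ∧ (Finite K ∨ ¬ K.FG)} := by
    refine ⟨fun K hK => hK.1, ⟨bot_le, Or.inl inferInstance⟩, ⟨le_rfl, Or.inr hG⟩, ?_, ?_⟩
    · intro K L hKL hLG hfi
      have h1 := finite_iff_of_relIndex_ne_zero hKL hfi.relIndex_ne_zero
      have h2 : L.FG ↔ K.FG := ⟨fg_of_relIndex_ne_zero_of_le hKL hfi.relIndex_ne_zero,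
        fg_of_relIndex_ne_zero hKL hfi.relIndex_ne_zero⟩
      change L ≤ G ∧ _ ↔ K ≤ G ∧ _
      simp only [h1, h2, hLG, hKL.trans hLG]
    · intro K hKfg hK hsec
      refine ⟨hK.trans inf_le_left, Or.inl (finite_of_finite_sections hK fun v hv => ?_)⟩
      exact (hsec v hv).2.resolve_right fun h => h (sectionSubgroup_fg hK hKfg hv)
  rcases (hind _ hX H hHG hfg).2 with h | h
  · exact not_finite H
  · exact h hfg

/-- A weakly branch group with the subgroup induction property is torsion. -/
theorem finite_zpowers_of_subgroupInduction (hb : IsWeaklyBranch G)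
    (hind : HasSubgroupInduction G) {g : TreeAut d} (hg : g ∈ G) :
    Finite (Subgroup.zpowers g) := by
  -- The subgroups that are finite or not virtually abelian; an infinite cyclic group is neither.
  have hX : IsInductiveClass G {K | K ≤ G ∧ (Finite K ∨
      ∀ P ≤ K, P.relIndex K ≠ 0 → ∃ x ∈ P, ∃ y ∈ P, x * y ≠ y * x)} := by
    refine ⟨fun K hK => hK.1, ⟨bot_le, Or.inl inferInstance⟩,
      ⟨le_rfl, Or.inr fun P _ hP => exists_not_commute hb hP⟩, ?_, ?_⟩
    · intro K L hKL hLG hfi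
      have h1 := finite_iff_of_relIndex_ne_zero hKL hfi.relIndex_ne_zero
      constructor
      · rintro ⟨-, h⟩
        refine ⟨hKL.trans hLG, h.imp h1.1 fun h P hPK hP => ?_⟩
        exact h P (hPK.trans hKL) (Subgroup.relIndex_ne_zero_trans hP hfi.relIndex_ne_zero)
      · rintro ⟨-, h⟩
        refine ⟨hLG, h.imp h1.2 fun h P hPL hP => ?_⟩
        obtain ⟨x, hx, y, hy, hxy⟩ := h (P ⊓ K) inf_le_right (by
          rw [Subgroup.inf_relIndex_right]
          exact relIndex_ne_zero_of_le_right hKL hP)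
        exact ⟨x, hx.1, y, hy.1, hxy⟩
    · intro K _ hK hsec
      refine ⟨hK.trans inf_le_left, ?_⟩
      by_cases hall : ∀ v ∈ level d 1, Finite (sectionSubgroup K v)
      · exact Or.inl (finite_of_finite_sections hK hall)
      · push Not at hall
        obtain ⟨v, hv, hvinf⟩ := hall
        right
        intro P hPK hP
        obtain ⟨_, ⟨⟨x, hxv⟩, hx, rfl⟩, _, ⟨⟨y, hyv⟩, hy, rfl⟩, hxy⟩ :=
          (hsec v hv).2.resolve_left (fun h => not_finite (sectionSubgroup K v))
          (sectionSubgroup P v) (sectionSubgroup_mono hPK v)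
          (sectionSubgroup_relIndex_ne_zero hP v)
        refine ⟨x, hx, y, hy, fun h => hxy ?_⟩
        rw [← map_mul, ← map_mul]
        exact congrArg _ (Subtype.ext h)
  have hfg : (Subgroup.zpowers g).FG :=
    (Subgroup.fg_iff _).2 ⟨{g}, (Subgroup.zpowers_eq_closure g).symm, Set.finite_singleton g⟩
  refine (hind _ hX _ ((Subgroup.zpowers_le).2 hg) hfg).2.resolve_right fun h => ?_
  obtain ⟨_, ⟨m, rfl⟩, _, ⟨n, rfl⟩, hmn⟩ := h _ le_rfl (by simp)
  exact hmn ((Commute.refl g).zpow_zpow m n)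

theorem commutator_relIndex_ne_zero {B : Type*} [Group B] {R : Subgroup B} (hR : R.FG)
    (htor : ∀ g ∈ R, IsOfFinOrder g) : ⁅R, R⁆.relIndex R ≠ 0 := by
  have h1 : Group.FG R := (Group.fg_iff_subgroup_fg R).2 hR
  have h2 : Group.FG (Abelianization R) :=
    Group.fg_of_surjective (f := Abelianization.of) QuotientGroup.mk_surjective
  have h3 : Finite (Abelianization R) := CommGroup.finite_of_fg_isMulTorsion _ (by
    intro x
    obtain ⟨y, rfl⟩ : ∃ y, Abelianization.of y = x := QuotientGroup.mk_surjective x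
    exact Abelianization.of.isOfFinOrder
      ((Submonoid.isOfFinOrder_coe (H := R.toSubmonoid) (x := y)).1 (htor y y.2)))
  have h4 : (commutator R).index ≠ 0 := Subgroup.index_ne_zero_iff_finite.2 h3
  rwa [← Subgroup.map_subtype_commutator, relIndex_map_subtype]

theorem hasFiniteAbelianizations (hG : G.FG) (htor : ∀ g ∈ G, IsOfFinOrder g) :
    HasFiniteAbelianizations G := fun _ hRG hR =>
  Subgroup.relIndex_ne_zero_trans (commutator_relIndex_ne_zero
    (fg_of_relIndex_ne_zero_of_le hRG hR hG) fun g hg => htor g (hRG hg)) hR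

/-- Tameness is taken inside `G`, since closedness refers to finite index subgroups of `G`. The
section axiom is `IsTame.of_sections` for the embedding `σ` of the level stabilizer into a power of
`G`. -/
theorem isTame_of_subgroupInduction (hss : IsSelfSimilar G) (hΓ : HasVirtualComplements G)
    (hind : HasSubgroupInduction G) {H : Subgroup (TreeAut d)} (hHG : H ≤ G) (hfg : H.FG) :
    IsTame G (H.subgroupOf G) := by
  have hX : IsInductiveClass G {K | K ≤ G ∧ IsTame G (K.subgroupOf G)} := by
    refine ⟨fun K hK => hK.1, ⟨bot_le, ?_⟩, ⟨le_rfl, ?_⟩, ?_, ?_⟩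
    · rw [Subgroup.bot_subgroupOf]
      exact isTame_bot
    · rw [Subgroup.subgroupOf_self]
      exact isTame_top
    · intro K L hKL hLG hfi
      have h := IsTame.iff_of_relIndex_ne_zero (Γ := G) (Subgroup.comap_mono (f := G.subtype) hKL)
        (Subgroup.relIndex_comap_ne_zero _ hfi.relIndex_ne_zero)
      exact ⟨fun hL => ⟨hKL.trans hLG, h.1 hL.2⟩, fun hK => ⟨hLG, h.2 hK.2⟩⟩
    · intro K _ hK hsec
      refine ⟨hK.trans inf_le_left, ?_⟩
      let S : Subgroup G := (stabLevel G 1).subgroupOf G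
      have hS : ∀ x : S, (x : TreeAut d) ∈ stabLevel (⊤ : Subgroup (TreeAut d)) 1 := fun x =>
        mem_stabLevel.2 ⟨trivial, (mem_stabLevel.1 x.2).2⟩
      let ι : S →* stabLevel (⊤ : Subgroup (TreeAut d)) 1 :=
        (G.subtype.comp S.subtype).codRestrict _ hS
      let σ : S →* (level d 1 → G) := MonoidHom.pi fun v =>
        ((Pi.evalMonoidHom (fun _ => TreeAut d) v).comp ((levelSections d 1).comp ι)).codRestrict G
          fun x => hss v.1 (sectionAt_mem_sectionSubgroup x.1.2 ((mem_stabLevel.1 x.2).2 v.1 v.2))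
      have hσ : ∀ x v, (σ x v : TreeAut d) = (x : TreeAut d).sectionAt v.1 := fun _ _ => rfl
      have hinj : Function.Injective σ := by
        refine (injective_iff_map_eq_one _).2 fun x hx => Subtype.ext (Subtype.ext ?_)
        refine eq_one_of_sectionAt_eq_one (mem_stabLevel.1 x.2).2 fun v hv => ?_
        rw [← hσ x ⟨v, hv⟩, hx]
        rfl
      refine IsTame.of_sections hΓ (stabLevel_relIndex_ne_zero G 1) hinj
        (Subgroup.comap_mono (f := G.subtype) hK) fun v => ?_
      convert (hsec v.1 v.2).2 using 1
      ext y
      constructor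
      · rintro ⟨_, ⟨x, hx, rfl⟩, rfl⟩
        exact sectionAt_mem_sectionSubgroup hx ((mem_stabLevel.1 x.2).2 v.1 v.2)
      · intro hy
        obtain ⟨g, ⟨hg, -⟩, hgy⟩ := mem_sectionSubgroup.1 (Subgroup.mem_subgroupOf.1 hy)
        have hgS := hK hg
        exact ⟨_, ⟨⟨⟨g, (mem_stabLevel.1 hgS).1⟩, hgS⟩, hg, rfl⟩, Subtype.ext hgy⟩
  exact (hind _ hX H hHG hfg).2

end Induction

/-! ### Nilpotent finite quotients and maximal subgroups. -/

section Maximal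

open scoped commutatorElement

theorem lowerCentralSeries_mono_left {B : Type*} [Group B] {S T : Subgroup B} (h : S ≤ T)
    (n : ℕ) : S.lowerCentralSeries n ≤ T.lowerCentralSeries n := by
  induction n with
  | zero => exact h
  | succ n ih => exact Subgroup.commutator_mono ih h

/-- Every finite index subgroup contains a term of the lower central series. -/
def HasNilpotentFiniteQuotients (B : Type*) [Group B] : Prop :=
  ∀ U : Subgroup B, U.index ≠ 0 → ∃ c, (⊤ : Subgroup B).lowerCentralSeries c ≤ U

theorem HasNilpotentFiniteQuotients.pi {Γ ι : Type*} [Group Γ] [Finite ι]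
    (hΓ : HasNilpotentFiniteQuotients Γ) : HasNilpotentFiniteQuotients (ι → Γ) := by
  classical
  intro U hU
  choose c hc using fun i => hΓ (U.comap (MonoidHom.mulSingle (fun _ : ι => Γ) i))
    (index_comap_ne_zero _ hU)
  obtain ⟨C, hC⟩ := (Set.finite_range c).bddAbove
  refine ⟨C, fun x hx => Subgroup.pi_mem_of_mulSingle_mem x fun i => hc i ?_⟩
  refine Subgroup.lowerCentralSeries_antitone _ (hC ⟨i, rfl⟩) ?_
  refine lowerCentralSeries_mono_left le_top C (S := (⊤ : Subgroup (ι → Γ)).map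
    (Pi.evalMonoidHom (fun _ => Γ) i)) ?_
  rw [← Subgroup.map_lowerCentralSeries]
  exact ⟨x, hx, rfl⟩

theorem HasNilpotentFiniteQuotients.of_isVirtualIso {A B : Type*} [Group A] [Group B]
    (hB : HasNilpotentFiniteQuotients B) {f : A →* B} (hf : IsVirtualIso f) :
    HasNilpotentFiniteQuotients A := by
  intro U hU
  obtain ⟨c, hc⟩ := hB (U.map f) (index_map_ne_zero hf.2 hU)
  refine ⟨c, ?_⟩
  rw [← Subgroup.map_le_map_iff_of_injective hf.1, Subgroup.map_lowerCentralSeries]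
  exact (lowerCentralSeries_mono_left le_top c).trans hc

/-- Modulo the next term `δ`, the term `γ` is central, so by `B = V γ` every commutator of `B`
agrees modulo `δ` with one of `V`. Hence `[B, B] ≤ V δ`. The series is numbered from `0`, so term
`1` is the derived subgroup. -/
theorem sup_lowerCentralSeries_eq_top {B : Type*} [Group B] {V : Subgroup B}
    (hV : V ⊔ commutator B = ⊤) (i : ℕ) :
    V ⊔ (⊤ : Subgroup B).lowerCentralSeries (i + 1) = ⊤ := by
  induction i with
  | zero => rwa [zero_add, Subgroup.top_lowerCentralSeries_one]
  | succ i ih =>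
    set γ := (⊤ : Subgroup B).lowerCentralSeries (i + 1) with hγ
    set δ := (⊤ : Subgroup B).lowerCentralSeries (i + 1 + 1) with hδ
    let q := QuotientGroup.mk' δ
    have hcen : ∀ a ∈ γ, ∀ z, q a * q z = q z * q a := by
      intro a ha z
      have h1 : ⁅a, z⁆ ∈ δ := Subgroup.commutator_mem_commutator ha trivial
      have h2 : q ⁅a, z⁆ = 1 := (QuotientGroup.eq_one_iff _).2 h1
      rwa [map_commutatorElement, commutatorElement_eq_one_iff_mul_comm] at h2
    have hle : commutator B ≤ V ⊔ δ := by
      rw [commutator_def, Subgroup.commutator_le]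
      intro x _ y _
      obtain ⟨v, hv, a, ha, rfl⟩ := Subgroup.mem_sup_of_normal_right.1 (ih ▸ Subgroup.mem_top x)
      obtain ⟨w, hw, b, hb, rfl⟩ := Subgroup.mem_sup_of_normal_right.1 (ih ▸ Subgroup.mem_top y)
      have h1 : q ⁅v * a, w * b⁆ = q ⁅v, w⁆ := by
        simp only [commutatorElement_def, map_mul, map_inv]
        have h2 : q v * q a * (q w * q b) = q v * q w * (q a * q b) := by
          rw [mul_assoc, ← mul_assoc (q a), hcen a ha w]
          simp only [mul_assoc]
        have h3 : q w * q b * (q v * q a) = q w * q v * (q a * q b) := by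
          rw [mul_assoc, ← mul_assoc (q b), hcen b hb v, hcen a ha b]
          simp only [mul_assoc]
        rw [h2, mul_assoc _ (q v * q a)⁻¹, ← mul_inv_rev, h3]
        group
      have h4 : ⁅v, w⁆⁻¹ * ⁅v * a, w * b⁆ ∈ δ := by
        rw [← QuotientGroup.eq]
        exact h1.symm
      have h5 : ⁅v * a, w * b⁆ = ⁅v, w⁆ * (⁅v, w⁆⁻¹ * ⁅v * a, w * b⁆) := by group
      rw [h5]
      refine Subgroup.mul_mem_sup ?_ h4
      exact V.mul_mem (V.mul_mem (V.mul_mem hv hw) (V.inv_mem hv)) (V.inv_mem hw)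
    exact top_le_iff.1 (hV ▸ sup_le le_sup_left hle)

theorem HasNilpotentFiniteQuotients.eq_top {B : Type*} [Group B]
    (hB : HasNilpotentFiniteQuotients B) {V : Subgroup B} (hV : V.index ≠ 0)
    (h : V ⊔ commutator B = ⊤) : V = ⊤ := by
  obtain ⟨c, hc⟩ := hB V hV
  rw [← sup_lowerCentralSeries_eq_top h c]
  exact (sup_eq_left.2 ((Subgroup.lowerCentralSeries_antitone _ (Nat.le_succ c)).trans hc)).symm

/-- A group is generated by a finitely generated subgroup of `M` together with the normal subgroup
`E`, if it is finitely generated and generated by `M` and `E`. -/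
theorem exists_fg_le_sup_eq_top {B : Type*} [Group B] (hB : Group.FG B) {M E : Subgroup B}
    [E.Normal] (h : M ⊔ E = ⊤) : ∃ M₀ ≤ M, M₀.FG ∧ M₀ ⊔ E = ⊤ := by
  obtain ⟨s, hs, hsfin⟩ := Group.fg_iff.1 hB
  have h1 : ∀ x : B, ∃ m ∈ M, m⁻¹ * x ∈ E := by
    intro x
    obtain ⟨m, hm, e, he, rfl⟩ := Subgroup.mem_sup_of_normal_right.1 (h ▸ Subgroup.mem_top x)
    exact ⟨m, hm, by simpa using he⟩
  choose m hm hmE using h1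
  refine ⟨Subgroup.closure (m '' s), (Subgroup.closure_le _).2 ?_,
    (Subgroup.fg_iff _).2 ⟨m '' s, rfl, hsfin.image m⟩, ?_⟩
  · rintro _ ⟨x, _, rfl⟩
    exact hm x
  · rw [← top_le_iff, ← hs, Subgroup.closure_le]
    intro x hx
    have h2 := Subgroup.mul_mem_sup (Subgroup.subset_closure (Set.mem_image_of_mem m hx)) (hmE x)
    rwa [mul_inv_cancel_left] at h2

/-- The maximal subgroups of a finitely generated group `B` have finite index if the finitely
generated subgroups are closed and `B` has a normal subgroup `C` of finite index with nilpotent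
finite quotients and finite abelianization. -/
theorem finiteIndex_of_isCoatom {B : Type*} [Group B] (hB : Group.FG B)
    (hsep : ∀ K : Subgroup B, K.FG → IsSeparable K) {C : Subgroup B} [C.Normal]
    (hC : C.index ≠ 0) (hnil : HasNilpotentFiniteQuotients C) (hab : ⁅C, C⁆.relIndex C ≠ 0)
    {M : Subgroup B} (hM : IsCoatom M) : M.FiniteIndex := by
  by_contra hMi
  have hE : (⁅C, C⁆ : Subgroup B).index ≠ 0 := index_ne_zero_of_relIndex hab hC
  -- `M` has infinite index, so it cannot contain the finite index subgroup `[C, C]`; maximality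
  -- does the rest.
  have hsup : M ⊔ ⁅C, C⁆ = ⊤ := by
    refine hM.2 _ (left_lt_sup.2 fun hle => hMi ⟨index_ne_zero_of_le hle hE⟩)
  obtain ⟨M₀, hM₀, hfg, hM₀E⟩ := exists_fg_le_sup_eq_top hB hsup
  have hne : M₀ ≠ ⊤ := fun h => hM.1 (top_le_iff.1 (h ▸ hM₀))
  obtain ⟨x, hx⟩ : ∃ x, x ∉ M₀ := by
    by_contra hall
    push Not at hall
    exact hne (top_le_iff.1 fun x _ => hall x)
  obtain ⟨U, hU, hM₀U, hxU⟩ := hsep M₀ hfg x hx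
  have hUE : U ⊔ ⁅C, C⁆ = ⊤ := top_le_iff.1 (hM₀E ▸ sup_le_sup_right hM₀U _)
  -- By the modular law `(U ⊓ C) [C, C] = C`, and nilpotency of the finite quotients of `C` gives `U
  -- ⊓ C = C`.
  have hUC : U.subgroupOf C = ⊤ := by
    refine hnil.eq_top (relIndex_ne_zero_of_index hU C) ?_
    rw [← top_le_iff]
    rintro y -
    obtain ⟨u, hu, e, he, hue⟩ := Subgroup.mem_sup_of_normal_right.1
      (hUE ▸ Subgroup.mem_top (y : B))
    have heC : e ∈ C := Subgroup.commutator_le_self C he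
    have huC : u ∈ C := by
      rw [eq_mul_inv_of_mul_eq hue]
      exact C.mul_mem y.2 (C.inv_mem heC)
    rw [← Subgroup.map_subtype_commutator] at he
    obtain ⟨e', he', rfl⟩ := he
    have hy : y = ⟨u, huC⟩ * e' := Subtype.ext hue.symm
    rw [hy]
    exact Subgroup.mul_mem_sup hu he'
  have hCU : C ≤ U := Subgroup.subgroupOf_eq_top.1 hUC
  rw [sup_eq_left.2 ((Subgroup.commutator_le_self C).trans hCU)] at hUE
  exact hxU (hUE ▸ Subgroup.mem_top x)

end Maximal

/-! ### From a nontrivial `Φ_F(G)` to nilpotent finite quotients. -/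

section FrattiniSubgroup

theorem conj_mem_frattiniFinite {A : Type*} [Group A] (g : A) {x : A}
    (hx : x ∈ frattiniFinite A) : g * x * g⁻¹ ∈ frattiniFinite A := by
  rw [frattiniFinite, Subgroup.mem_sInf] at hx ⊢
  rintro M ⟨hM, hMi⟩
  let e : A ≃* A := (MulAut.conj g).symm
  have h1 : IsCoatom (M.map e.toMonoidHom) := (e.mapSubgroup.isCoatom_iff M).2 hM
  have h2 : (M.map e.toMonoidHom).FiniteIndex :=
    ⟨by rw [Subgroup.index_map_of_bijective e.bijective]; exact hMi.index_ne_zero⟩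
  obtain ⟨y, hy, hyx⟩ := hx _ ⟨h1, h2⟩
  have h3 : x = g⁻¹ * y * g := hyx.symm
  have h4 : g * x * g⁻¹ = y := by rw [h3]; group
  rwa [h4]

theorem map_frattiniFinite_le {A Q : Type*} [Group A] [Group Q] [Finite Q] {q : A →* Q}
    (hq : Function.Surjective q) : (frattiniFinite A).map q ≤ frattini Q := by
  rintro _ ⟨x, hx, rfl⟩
  have hx' := Subgroup.mem_sInf.1 hx
  simp only [frattini, Order.radical, Subgroup.mem_iInf]
  intro K hK
  refine hx' (K.comap q) ⟨Subgroup.isCoatom_comap_of_surjective hq hK, ⟨?_⟩⟩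
  exact index_comap_ne_zero q Subgroup.FiniteIndex.index_ne_zero

variable {d : ℕ} {G : Subgroup (TreeAut d)}

/-- If `N` moves one vertex, then by transitivity it moves every vertex of that level, so it
contains all the derived subgroups of the rigid stabilizers there. -/
theorem relIndex_ne_zero_of_normal (hrep : IsSelfReplicating G) (hb : IsBranch G)
    (hab : HasFiniteAbelianizations G) {N : Subgroup (TreeAut d)} (hNG : N ≤ G)
    (hN : ∀ l ∈ G, ∀ x ∈ N, l * x * l⁻¹ ∈ N) (hne : N ≠ ⊥) : N.relIndex G ≠ 0 := by
  obtain ⟨⟨x, hx⟩, hx1'⟩ := (Subgroup.ne_bot_iff_exists_ne_one (H := N)).1 hne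
  have hx1 : x ≠ 1 := fun h => hx1' (Subtype.ext h)
  obtain ⟨v, hv⟩ := exists_apply_ne hx1
  refine relIndex_ne_zero_of_le (sectionProduct_le_of_forall_le (n := v.length) (G := G)
    (K := fun w => ⁅rist G w.1, rist G w.1⁆) (fun w => Subgroup.commutator_le_self _)
    fun w => ?_) (sectionProduct_relIndex_ne_zero hrep.1 fun w =>
      sectionSubgroup_commutator_rist_relIndex_ne_zero hrep hb hab le_rfl (by simp) w.1)
  obtain ⟨g, hg, hgw⟩ := hb.transitive v.length v rfl w.1 w.2
  have hgw' : g v = w.1 := hgw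
  refine commutator_rist_le hNG hN (hN g hg x hx) fun h => hv (g.injective ?_)
  rwa [TreeAut.mul_apply, TreeAut.mul_apply, TreeAut.inv_apply_eq hgw', ← hgw'] at h

theorem conj_mem_stabLevel {n : ℕ} {g x : TreeAut d} (hg : g ∈ G) (hx : x ∈ stabLevel G n) :
    g * x * g⁻¹ ∈ stabLevel G n := by
  rw [mem_stabLevel] at hx ⊢
  refine ⟨G.mul_mem (G.mul_mem hg hx.1) (G.inv_mem hg), fun v hv => ?_⟩
  rw [TreeAut.mul_apply, TreeAut.mul_apply, hx.2 _ ((g⁻¹.length_eq v).trans hv),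
    g.apply_inv_self]

/-- The image of `Stab(n)` in the finite group `G / Stab(n + m)` lies in its Frattini subgroup,
which is nilpotent, so a lower central term of `Stab(n)` lies in `Stab(n + m)`. The section at a
vertex of level `n` carries `Stab(n)` onto `G` and `Stab(n + m)` into `Stab(m)`. -/
theorem lowerCentralSeries_le_stabLevel (hd : 0 < d) (hstr : IsStronglySelfReplicating G) {n : ℕ}
    (hn : stabLevel G n ≤ (frattiniFinite G).map G.subtype) (m : ℕ) :
    ∃ c, G.lowerCentralSeries c ≤ stabLevel G m := by
  let T : Subgroup G := (stabLevel G (n + m)).subgroupOf G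
  have hTn : T.Normal := ⟨fun x hx g => conj_mem_stabLevel g.2 hx⟩
  have hTi : T.FiniteIndex := ⟨stabLevel_relIndex_ne_zero G (n + m)⟩
  let q := QuotientGroup.mk' T
  have hfr : ((stabLevel G n).subgroupOf G).map q ≤ frattini (G ⧸ T) := by
    refine le_trans (Subgroup.map_mono fun x hx => ?_)
      (map_frattiniFinite_le (QuotientGroup.mk'_surjective T))
    obtain ⟨y, hy, hyx⟩ := hn hx
    rwa [← G.subtype_injective hyx]
  obtain ⟨c, hc⟩ := (Subgroup.isNilpotent_iff_lowerCentralSeries _).1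
    (frattini_nilpotent (G := G ⧸ T))
  have h1 : ((stabLevel G n).subgroupOf G).lowerCentralSeries c ≤ T := by
    have h2 : (((stabLevel G n).subgroupOf G).lowerCentralSeries c).map q ≤ ⊥ := by
      rw [Subgroup.map_lowerCentralSeries, ← hc]
      exact lowerCentralSeries_mono_left hfr c
    intro x hx
    exact (QuotientGroup.eq_one_iff x).1 (h2 ⟨x, hx, rfl⟩)
  have h3 : (stabLevel G n).lowerCentralSeries c ≤ stabLevel G (n + m) := by
    have h4 := Subgroup.map_mono (f := G.subtype) h1
    rw [Subgroup.map_lowerCentralSeries, Subgroup.subgroupOf_map_subtype,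
      inf_eq_left.2 (show stabLevel G n ≤ G from inf_le_left)] at h4
    exact h4.trans (by rw [Subgroup.subgroupOf_map_subtype]; exact inf_le_left)
  let v : List (Fin d) := List.replicate n ⟨0, hd⟩
  have hv : v.length = n := by simp [v]
  let R : Subgroup (MulAction.stabilizer (TreeAut d) v) :=
    (stabLevel G n).subgroupOf (MulAction.stabilizer (TreeAut d) v)
  have hle : stabLevel G n ≤ MulAction.stabilizer (TreeAut d) v := fun g hg =>
    (mem_stabLevel.1 hg).2 v hv
  have hR : R.map (sectionHom v) = G := hstr.2 n v hv
  refine ⟨c, ?_⟩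
  have h0 := Subgroup.map_lowerCentralSeries R (sectionHom v) c
  rw [hR] at h0
  rw [← h0]
  rintro _ ⟨y, hy, rfl⟩
  have hy' : (y : TreeAut d) ∈ stabLevel G (n + m) := by
    apply h3
    have h5 : (R.lowerCentralSeries c).map (MulAction.stabilizer (TreeAut d) v).subtype =
        (stabLevel G n).lowerCentralSeries c := by
      rw [Subgroup.map_lowerCentralSeries, Subgroup.subgroupOf_map_subtype, inf_eq_left.2 hle]
    rw [← h5]
    exact ⟨y, hy, rfl⟩
  rw [mem_stabLevel] at hy'
  refine mem_stabLevel.2 ⟨hstr.1 v (sectionAt_mem_sectionSubgroup hy'.1 y.2), fun w hw => ?_⟩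
  have h6 := sectionAt_apply_of_fixed y.2 w
  rw [hy'.2 (v ++ w) (by simp [hv, hw])] at h6
  exact List.append_cancel_left h6

theorem hasNilpotentFiniteQuotients (hd : 0 < d) (hrep : IsSelfReplicating G) (hb : IsBranch G)
    (hab : HasFiniteAbelianizations G) (hstr : IsStronglySelfReplicating G)
    (hcsp : HasCongruenceSubgroupProperty G) (hF : frattiniFinite G ≠ ⊥) :
    HasNilpotentFiniteQuotients G := by
  have hFi : ((frattiniFinite G).map G.subtype).relIndex G ≠ 0 := by
    refine relIndex_ne_zero_of_normal hrep hb hab (Subgroup.map_subtype_le _) ?_ ?_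
    · rintro l hl _ ⟨x, hx, rfl⟩
      exact ⟨_, conj_mem_frattiniFinite ⟨l, hl⟩ hx, rfl⟩
    · rwa [Ne, Subgroup.map_eq_bot_iff_of_injective _ G.subtype_injective]
  obtain ⟨n, hn⟩ := hcsp _ (Subgroup.map_subtype_le _) ⟨hFi⟩
  intro U hU
  obtain ⟨m, hm⟩ := hcsp (U.map G.subtype) (Subgroup.map_subtype_le _)
    ⟨by rwa [relIndex_map_subtype]⟩
  obtain ⟨c, hc⟩ := lowerCentralSeries_le_stabLevel hd hstr hn m
  refine ⟨c, ?_⟩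
  rw [← Subgroup.map_le_map_iff_of_injective G.subtype_injective,
    Subgroup.top_subtype_lowerCentralSeries]
  exact hc.trans hm

end FrattiniSubgroup

/-- While at least `d` factors remain, `d` of them can be traded for one. -/
theorem exists_power_lt_degree {A Γ : Type} [Group A] [Group Γ] {d : ℕ} (hd : 2 ≤ d)
    (hΓ : GroupCommensurable Γ (Fin d → Γ)) (k : ℕ) (hk : 1 ≤ k)
    (h : GroupCommensurable A (Fin k → Γ)) :
    ∃ k : ℕ, 1 ≤ k ∧ k ≤ d - 1 ∧ GroupCommensurable A (Fin k → Γ) := by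
  induction k using Nat.strong_induction_on with
  | _ k ih =>
    by_cases hkd : k ≤ d - 1
    · exact ⟨k, hk, hkd, h⟩
    · obtain ⟨j, rfl⟩ : ∃ j, k = j + d := ⟨k - d, by omega⟩
      refine ih (j + 1) (by omega) (by omega) ?_
      have h1 : GroupCommensurable (Fin d → Γ) (Fin 1 → Γ) :=
        hΓ.symm.trans (.of_mulEquiv (MulEquiv.piUnique fun _ : Fin 1 => Γ).symm)
      have h2 := (GroupCommensurable.refl (Fin j → Γ)).pow_add (.refl (Fin d → Γ))
      exact (h.trans h2.symm).trans ((GroupCommensurable.refl (Fin j → Γ)).pow_add h1)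

end RootedTree

open RootedTree in
theorem mainTheorem3 (d : ℕ) (hd : 2 ≤ d) (G : Subgroup (RootedTree.TreeAut d))
    (hrep : RootedTree.IsSelfReplicating G) (hbranch : RootedTree.IsBranch G)
    (hstab : ∀ v ∈ RootedTree.level d 1, RootedTree.stab G v = RootedTree.stabLevel G 1)
    (hind : RootedTree.HasSubgroupInduction G)
    (H : Subgroup (RootedTree.TreeAut d)) (hHG : H ≤ G) (hfg : H.FG) (hinf : Infinite H) :
    (∃ k : ℕ, 1 ≤ k ∧ k ≤ d - 1 ∧ RootedTree.GroupCommensurable H (Fin k → G)) ∧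
    (RootedTree.IsStronglySelfReplicating G → RootedTree.HasCongruenceSubgroupProperty G →
      RootedTree.frattiniFinite G ≠ ⊥ →
      ∀ M : Subgroup H, IsCoatom M → M.FiniteIndex) := by
  have hd0 : 0 < d := by omega
  have hGfg : G.FG := fg_of_subgroupInduction hind hHG hfg hinf
  have htor : ∀ g ∈ G, IsOfFinOrder g := fun g hg => by
    have := finite_zpowers_of_subgroupInduction hbranch.toIsWeaklyBranch hind hg
    exact finite_zpowers.1 (Set.toFinite (Subgroup.zpowers g : Set (TreeAut d)))
  have hab := hasFiniteAbelianizations hGfg htor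
  have hΓ := hasVirtualComplements hd0 hrep hbranch hab
  obtain ⟨k, hk⟩ : IsCommensurableToPower G H :=
    (isTame_of_subgroupInduction hrep.1 hΓ hind hHG hfg).2.of_groupCommensurable
      (.of_mulEquiv (Subgroup.subgroupOfEquivOfLe hHG).symm)
  have hHfg : Group.FG H := (Group.fg_iff_subgroup_fg H).2 hfg
  refine ⟨exists_power_lt_degree hd (groupCommensurable_pow_degree hrep hbranch) k ?_ hk, ?_⟩
  -- Exponent `0` would make `H` finite.
  · by_contra hk0
    obtain rfl : k = 0 := by omega
    obtain ⟨A₁, B₁, hA, -, ⟨e⟩⟩ := hk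
    have hfin : Finite A₁ := Finite.of_injective e e.injective
    have hfinH : Finite H := Subgroup.finite_iff_finite_and_finiteIndex (H := A₁) |>.2 ⟨hfin, hA⟩
    exact not_finite H
  · intro hstr hcsp hF M hM
    have hnil := hasNilpotentFiniteQuotients hd0 hrep hbranch hab hstr hcsp hF
    obtain ⟨A₁, B₁, hA, hB, ⟨e⟩⟩ := hk
    -- The criterion for maximal subgroups needs a normal subgroup; nilpotency of finite quotients
    -- passes to finite index subgroups.
    let C : Subgroup H := A₁.normalCore
    have hC : C.index ≠ 0 := (Subgroup.finiteIndex_normalCore A₁).index_ne_zero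
    have hCA : C ≤ A₁ := A₁.normalCore_le
    have hincl : IsVirtualIso (Subgroup.inclusion hCA) := by
      refine ⟨Subgroup.inclusion_injective hCA, ?_⟩
      rw [Subgroup.inclusion_range]
      exact relIndex_ne_zero_of_index hC A₁
    have hCnil : HasNilpotentFiniteQuotients C := hnil.pi.of_isVirtualIso
      (((IsVirtualIso.subtype hB.index_ne_zero).comp (IsVirtualIso.of_mulEquiv e)).comp hincl)
    refine finiteIndex_of_isCoatom hHfg (fun K hK => ?_) hC hCnil ?_ hM
    · have hKG : K.map H.subtype ≤ G := (Subgroup.map_subtype_le K).trans hHG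
      have hKfg : (K.map H.subtype).FG := by
        have : Group.FG K := (Group.fg_iff_subgroup_fg K).2 hK
        exact (Group.fg_iff_subgroup_fg _).1
          (Group.fg_of_surjective (H.subtype.subgroupMap_surjective K))
      have h := (isTame_of_subgroupInduction hrep.1 hΓ hind hKG hKfg).1.isSeparable.comap
        (Subgroup.inclusion hHG)
      have h2 : ((K.map H.subtype).subgroupOf G).comap (Subgroup.inclusion hHG) = K :=
        Subgroup.comap_map_eq_self_of_injective H.subtype_injective K
      rwa [h2] at h
    · refine commutator_relIndex_ne_zero
        (fg_of_relIndex_ne_zero_of_le le_top (by rwa [Subgroup.relIndex_top_right])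
          (Group.fg_def.1 hHfg)) fun g _ => ?_
      exact (Submonoid.isOfFinOrder_coe (H := H.toSubmonoid) (x := g)).1 (htor g (hHG g.2))
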